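/- Let $T\subset\mathbb{R}^2$ be a (closed, non-degenerate) triangle and let $j\ge 1$ be an integer. For a lattice $\Lambda\subset\mathbb{R}^2$ (of full rank), the family $T+\Lambda=\{T+v : v\in\Lambda\}$ is a $j$-fold lattice packing if every point of $\mathbb{R}^2$ belongs to the interiors of at most $j$ of the sets $T+v$, $v\in\Lambda$, and a $j$-fold lattice covering if every point of $\mathbb{R}^2$ belongs to at least $j$ of these sets. With $Q_l=[-l,l]^2$, let $$d_+(T+\Lambda)=\limsup_{l\to\infty}\frac{1}{|Q_l|}\sum_{v\in\Lambda,\ (T+v)\cap Q_l\neq\emptyset}|T+v|,\qquad d_-(T+\Lambda)=\liminf_{l\to\infty}\frac{1}{|Q_l|}\sum_{v\in\Lambda,\ T+v\subset Q_l}|T+v|,$$ where $|\cdot|$ is the area. Let $\delta_L^j(T)$ be the supremum of $d_+(T+\Lambda)$ over all $\Lambda$ such that $T+\Lambda$ is a $j$-fold lattice packing, and let $\vartheta_L^j(T)$ be the infimum of $d_-(T+\Lambda)$ over all $\Lambda$ such that $T+\Lambda$ is a $j$-fold lattice covering. Let $\Delta_L^j(T)$ be the set of lattices $\Lambda$ such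 that $T+\Lambda$ is a $j$-fold lattice packing with $d_+(T+\Lambda)=\delta_L^j(T)$, and let $\Theta_L^j(T)$ be the set of lattices $\Lambda$ such that $T+\Lambda$ is a $j$-fold lattice covering with $d_-(T+\Lambda)=\vartheta_L^j(T)$. Then both sets are finite and $$\operatorname{card}\Delta_L^j(T)=\operatorname{card}\Theta_L^j(T)=(2j+1)\prod_{p\mid 2j+1}\left(1-\frac{2}{p}\right),$$ where the product runs over the distinct primes $p$ dividing $2j+1$. -/

import Mathlib

open scoped ENNReal

noncomputable section

namespace MultipleLattice

/-- The Euclidean plane. -/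
abbrev Plane : Type := EuclideanSpace ℝ (Fin 2)

/-- The square `l I²`, where `I = [-1, 1]`. -/
def square (l : ℝ) : Set Plane := {x | ∀ i, x i ∈ Set.Icc (-l) l}

/-- The upper density of a family of plane sets with respect to `D`: the total area of the
members that meet `D`, divided by the area of `D`. -/
def upperDensityOn {ι : Type*} (F : ι → Set Plane) (D : Set Plane) : ℝ≥0∞ :=
  (∑' i : {i : ι // (F i ∩ D).Nonempty}, MeasureTheory.volume (F i)) / MeasureTheory.volume D

/-- The lower density of a family of plane sets with respect to `D`: the total area of the
members contained in `D`, divided by the area of `D`. -/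
def lowerDensityOn {ι : Type*} (F : ι → Set Plane) (D : Set Plane) : ℝ≥0∞ :=
  (∑' i : {i : ι // F i ⊆ D}, MeasureTheory.volume (F i)) / MeasureTheory.volume D

/-- The upper density of a family of plane sets. -/
def upperDensity {ι : Type*} (F : ι → Set Plane) : ℝ≥0∞ :=
  Filter.limsup (fun l : ℝ => upperDensityOn F (square l)) Filter.atTop

/-- The lower density of a family of plane sets. -/
def lowerDensity {ι : Type*} (F : ι → Set Plane) : ℝ≥0∞ :=
  Filter.liminf (fun l : ℝ => lowerDensityOn F (square l)) Filter.atTop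

/-- A `j`-fold packing of `D`: the members lie in `D`, and every point of `D` belongs to the
interiors of at most `j` members. -/
def IsFoldPacking {ι : Type*} (j : ℕ) (F : ι → Set Plane) (D : Set Plane) : Prop :=
  (⋃ i, F i) ⊆ D ∧ ∀ x ∈ D, {i | x ∈ interior (F i)}.encard ≤ j

/-- A `j`-fold covering of `D`: every point of `D` belongs to at least `j` members. -/
def IsFoldCovering {ι : Type*} (j : ℕ) (F : ι → Set Plane) (D : Set Plane) : Prop :=
  ∀ x ∈ D, (j : ℕ∞) ≤ {i | x ∈ F i}.encard

/-- A (full-rank) lattice in the plane. -/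
def IsLattice (L : Submodule ℤ Plane) : Prop :=
  ∃ _ : DiscreteTopology L, IsZLattice ℝ L

/-- The family `K + L` of all translates of `K` by vectors of `L`. -/
def translates (K : Set Plane) (L : Submodule ℤ Plane) : L → Set Plane :=
  fun v => (fun x : Plane => x + (v : Plane)) '' K

/-- The lattices `L` for which `K + L` is a `j`-fold lattice packing of the plane. -/
def packingLattices (j : ℕ) (K : Set Plane) : Set (Submodule ℤ Plane) :=
  {L | IsLattice L ∧ IsFoldPacking j (translates K L) Set.univ}

/-- The lattices `L` for which `K + L` is a `j`-fold lattice covering of the plane. -/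
def coveringLattices (j : ℕ) (K : Set Plane) : Set (Submodule ℤ Plane) :=
  {L | IsLattice L ∧ IsFoldCovering j (translates K L) Set.univ}

/-- The `j`-fold lattice packing density of `K`. -/
def latticePackingDensity (j : ℕ) (K : Set Plane) : ℝ≥0∞ :=
  ⨆ L ∈ packingLattices j K, upperDensity (translates K L)

/-- The `j`-fold lattice covering density of `K`. -/
def latticeCoveringDensity (j : ℕ) (K : Set Plane) : ℝ≥0∞ :=
  ⨅ L ∈ coveringLattices j K, lowerDensity (translates K L)

/-- The optimal lattices for `j`-fold lattice packing with `K`. -/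
def optimalPackingLattices (j : ℕ) (K : Set Plane) : Set (Submodule ℤ Plane) :=
  {L ∈ packingLattices j K | upperDensity (translates K L) = latticePackingDensity j K}

/-- The optimal lattices for `j`-fold lattice covering with `K`. -/
def optimalCoveringLattices (j : ℕ) (K : Set Plane) : Set (Submodule ℤ Plane) :=
  {L ∈ coveringLattices j K | lowerDensity (translates K L) = latticeCoveringDensity j K}

end MultipleLattice

end

/-! An affine map turns `T` into the right triangle with legs `s` on the axes, where `s = 2 j` for
packings and `s = 2 j + 1` for coverings. The density of a lattice family is the area of `T` over
the covolume, so packings ask for the least covolume and coverings for the greatest. In these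
normalisations both extremes are `2 j + 1`, and the extremal lattices are the same.

Fix a total group order on the plane that compares `x + y` first. It enumerates the points of each
coset of `L` in the closed quadrant (`rank`), and the first `j` points of all cosets form `stair L
j`. This set meets every coset `j` times, so its area is `j` times the covolume
(`measure_eq_of_encard_coset`). Its complement in the quadrant is upward closed and has at most `2 j
+ 1` minimal points (`interior_corners`, `exists_corners`), so the set is a staircase with at most
`2 j` steps. A packing puts these minimal points on or beyond the line `x + y = 2 j`; a covering
keeps the staircase within `x + y ≤ 2 j + 1`. With `N = 2 j` steps, both area problems have the
extreme value `N (N + 1) / 2`, attained only by the staircase with unit steps (`packing_sum`,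
`covering_sum`).

It remains to find the lattices with `j` points in every translate of `unitStair j`. Sliding the
staircase and comparing what its edges lose and gain forces `L` to be `y ≡ c x` modulo `2 j + 1`
with `c` and `c + 1` units (`exists_congruenceLattice`). Conversely, for such `c` the residues are
equidistributed in the discrete triangle (`triangleCount_eq`). The number of these `c` is
multiplicative and is computed at prime powers (`unitPairCount_eq`). -/

namespace MultipleLattice

open MeasureTheory Submodule

/-! ### Lattices, cosets and covolume. -/

section LatticeFacts

variable {E : Type*} [NormedAddCommGroup E] [NormedSpace ℝ E] [FiniteDimensional ℝ E]
  (L : Submodule ℤ E) [DiscreteTopology L] [IsZLattice ℝ L]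

/-- A lattice meets a bounded set in finitely many points. -/
theorem finite_inter_lattice {s : Set E} (hs : Bornology.IsBounded s) :
    (s ∩ (L : Set E)).Finite := by
  have h := ZSpan.setFinite_inter ((Module.Free.chooseBasis ℤ L).ofZLatticeBasis ℝ) hs
  rwa [(Module.Free.chooseBasis ℤ L).ofZLatticeBasis_span ℝ] at h

/-- Every point is at bounded distance from a lattice. -/
theorem exists_lattice_near : ∃ R : ℝ, 0 < R ∧ ∀ x : E, ∃ v ∈ L, ‖x - v‖ ≤ R := by
  have hs := (Module.Free.chooseBasis ℤ L).ofZLatticeBasis_span ℝ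
  set b := (Module.Free.chooseBasis ℤ L).ofZLatticeBasis ℝ
  refine ⟨∑ i, ‖b i‖ + 1, by positivity, fun x => ⟨ZSpan.floor b x, hs.le (ZSpan.floor b x).2, ?_⟩⟩
  have := ZSpan.norm_fract_le b x
  rw [ZSpan.fract] at this
  linarith

variable [MeasurableSpace E] [BorelSpace E] (μ : Measure E) [μ.IsAddHaarMeasure]

/-- A measurable set that meets every coset of a lattice in exactly `j` points has measure `j`
times the covolume. -/
theorem measure_eq_of_encard_coset {D : Set E} (hD : MeasurableSet D) (j : ℕ)
    (h : ∀ z : E, {q | q ∈ D ∧ q - z ∈ L}.encard = j) :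
    μ D = j * ENNReal.ofReal (ZLattice.covolume L μ) := by
  have hF := ZLattice.isAddFundamentalDomain (Module.Free.chooseBasis ℤ L) μ
  set F := ZSpan.fundamentalDomain ((Module.Free.chooseBasis ℤ L).ofZLatticeBasis ℝ)
  have : VAddInvariantMeasure L E μ := (inferInstance : VAddInvariantMeasure L.toAddSubgroup E μ)
  have : MeasurableVAdd L E := (inferInstance : MeasurableVAdd L.toAddSubgroup E)
  have hfin : μ F < ⊤ := (ZSpan.fundamentalDomain_isBounded _).measure_lt_top
  -- Cut `D` along the translates of the fundamental domain `F`: its measure is the integral over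
  -- `F` of the number of points of `D` in the coset of `x`, which is the constant `j`.
  rw [ZLattice.covolume_eq_measure_fundamentalDomain L μ hF, Measure.real,
    ENNReal.ofReal_toReal hfin.ne, ← lintegral_indicator_one hD, hF.lintegral_eq_tsum'',
    ← lintegral_tsum]
  · rw [← setLIntegral_const]
    congr 1
    ext x
    have h1 : ∀ g : L, D.indicator (1 : E → ℝ≥0∞) (g +ᵥ x)
        = ({g : L | g +ᵥ x ∈ D} : Set L).indicator (fun _ => (1 : ℝ≥0∞)) g := by
      intro g
      by_cases hg : g +ᵥ x ∈ D <;> simp [hg]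
    simp_rw [h1]
    rw [← tsum_subtype, ENNReal.tsum_set_const, mul_one]
    have h2 : {q | q ∈ D ∧ q - x ∈ L}
        = (fun g : L => g +ᵥ x) '' {g : L | g +ᵥ x ∈ D} := by
      ext q
      constructor
      · rintro ⟨hq, hqx⟩
        have : (⟨q - x, hqx⟩ : L) +ᵥ x = q := by
          rw [Submodule.vadd_def]; simp
        exact ⟨⟨q - x, hqx⟩, by simpa [this] using hq, this⟩
      · rintro ⟨g, hg, rfl⟩
        refine ⟨hg, ?_⟩
        simp [Submodule.vadd_def]
    have h3 := h x
    rw [h2, Function.Injective.encard_image] at h3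
    · rw [h3]; rfl
    · intro a b hab
      simpa [Submodule.vadd_def] using hab
  · intro g
    refine Measurable.aemeasurable ?_
    exact (measurable_one.indicator hD).comp (measurable_const_vadd g)

end LatticeFacts

/-- A planar lattice has a basis whose determinant is the covolume. -/
theorem exists_basis_det (L : Submodule ℤ (ℝ × ℝ)) [DiscreteTopology L] [IsZLattice ℝ L] :
    ∃ v ∈ L, ∃ w ∈ L, (∀ u ∈ L, ∃ a b : ℤ, u = a • v + b • w) ∧
      |v.1 * w.2 - v.2 * w.1| = ZLattice.covolume L := by
  have hr : Module.finrank ℤ L = 2 := by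
    rw [ZLattice.rank ℝ L]; simp
  let b : Module.Basis (Fin 2) ℤ L := Module.finBasisOfFinrankEq ℤ L hr
  refine ⟨b 0, (b 0).2, b 1, (b 1).2, ?_, ?_⟩
  · intro u hu
    refine ⟨b.repr ⟨u, hu⟩ 0, b.repr ⟨u, hu⟩ 1, ?_⟩
    have := congrArg (Subtype.val) (b.sum_repr ⟨u, hu⟩)
    rw [Fin.sum_univ_two] at this
    simpa using this.symm
  · rw [ZLattice.covolume_eq_det_mul_measureReal L volume b (Module.Basis.finTwoProd ℝ)]
    have hF : ZSpan.fundamentalDomain (Module.Basis.finTwoProd ℝ)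
        = Set.Ico (0 : ℝ) 1 ×ˢ Set.Ico (0 : ℝ) 1 := by
      ext x
      simp [ZSpan.mem_fundamentalDomain, Fin.forall_fin_two]
    rw [hF, Measure.real, Measure.volume_eq_prod, Measure.prod_prod, Module.Basis.det_apply, Matrix.det_fin_two]
    simp [Module.Basis.toMatrix_apply]
    ring_nf

/-! ### The group order, ranks in the quadrant, and the staircase. -/

/-- The positive vectors of the total group order on the plane that compares `x + y` first
and `x` next. -/
def Pos (v : ℝ × ℝ) : Prop := 0 < v.1 + v.2 ∨ (v.1 + v.2 = 0 ∧ 0 < v.1)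

theorem Pos.add {v w : ℝ × ℝ} (hv : Pos v) (hw : Pos w) : Pos (v + w) := by
  unfold Pos at *
  simp only [Prod.fst_add, Prod.snd_add]
  rcases hv with hv | hv <;> rcases hw with hw | hw
  · left; linarith
  · left; linarith [hw.1]
  · left; linarith [hv.1]
  · right; constructor <;> linarith [hv.1, hv.2, hw.1, hw.2]

theorem Pos.sum_nonneg {v : ℝ × ℝ} (hv : Pos v) : 0 ≤ v.1 + v.2 := by
  rcases hv with hv | hv
  · exact hv.le
  · exact hv.1.ge

theorem not_pos_zero : ¬ Pos (0 : ℝ × ℝ) := by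
  simp [Pos]

theorem pos_trichotomy (v : ℝ × ℝ) : Pos v ∨ v = 0 ∨ Pos (-v) := by
  unfold Pos
  simp only [Prod.fst_neg, Prod.snd_neg]
  rcases lt_trichotomy (v.1 + v.2) 0 with h | h | h
  · right; right; left; linarith
  · rcases lt_trichotomy v.1 0 with h' | h' | h'
    · right; right; right; constructor <;> linarith
    · right; left; ext
      · exact h'
      · simp; linarith
    · left; right; exact ⟨h, h'⟩
  · left; left; exact h

theorem not_pos_of_nonpos {v : ℝ × ℝ} (hv : v ≤ 0) : ¬ Pos v := by
  have h1 : v.1 ≤ 0 := hv.1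
  have h2 : v.2 ≤ 0 := hv.2
  rintro (h | ⟨h, h'⟩) <;> linarith

/-- The positive lattice vectors dominated by `p`; they correspond to the points of `p + L` in the
quadrant that precede `p`. -/
def below (L : Submodule ℤ (ℝ × ℝ)) (p : ℝ × ℝ) : Set (ℝ × ℝ) := {v | v ∈ L ∧ Pos v ∧ v ≤ p}

/-- The number of points of `p + L` in the quadrant that precede `p`. -/
noncomputable def rank (L : Submodule ℤ (ℝ × ℝ)) (p : ℝ × ℝ) : ℕ := (below L p).ncard

/-- The points of the quadrant that are among the first `j` of their coset. -/
def stair (L : Submodule ℤ (ℝ × ℝ)) (j : ℕ) : Set (ℝ × ℝ) := {p | 0 ≤ p ∧ rank L p < j}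

theorem below_mono (L : Submodule ℤ (ℝ × ℝ)) {p q : ℝ × ℝ} (h : p ≤ q) : below L p ⊆ below L q :=
  fun _ hv => ⟨hv.1, hv.2.1, hv.2.2.trans h⟩

section

variable (L : Submodule ℤ (ℝ × ℝ)) [DiscreteTopology L] [IsZLattice ℝ L]

/-- Positivity gives `0 ≤ v.1 + v.2`, which together with `v ≤ p` confines `v` to a box. -/
theorem below_finite (p : ℝ × ℝ) : (below L p).Finite := by
  refine (finite_inter_lattice L (Metric.isBounded_Icc ((-p.2, -p.1) : ℝ × ℝ) p)).subset ?_
  rintro v ⟨hv, hp, hle⟩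
  have := hp.sum_nonneg
  have h1 : v.1 ≤ p.1 := hle.1
  have h2 : v.2 ≤ p.2 := hle.2
  refine ⟨⟨⟨?_, ?_⟩, hle⟩, hv⟩
  · change -p.2 ≤ v.1; linarith
  · change -p.1 ≤ v.2; linarith

theorem rank_mono {p q : ℝ × ℝ} (h : p ≤ q) : rank L p ≤ rank L q :=
  Set.ncard_le_ncard (below_mono L h) (below_finite L q)

/-- Adding `q - p` carries `below L p` into `below L q` and misses `q - p` itself, since `0` is not
positive. Hence rank is strictly increasing along a coset. -/
theorem rank_lt_of_pos {p q : ℝ × ℝ} (hp : 0 ≤ p) (hL : q - p ∈ L) (hpos : Pos (q - p)) :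
    rank L p < rank L q := by
  have hinj : Function.Injective (fun v : ℝ × ℝ => v + (q - p)) := add_left_injective _
  have h1 : rank L p = ((fun v : ℝ × ℝ => v + (q - p)) '' below L p).ncard :=
    (Set.ncard_image_of_injective _ hinj).symm
  rw [h1]
  refine Set.ncard_lt_ncard ⟨?_, ?_⟩ (below_finite L q)
  · rintro _ ⟨v, ⟨hv, hvp, hle⟩, rfl⟩
    refine ⟨add_mem hv hL, hvp.add hpos, ?_⟩
    calc v + (q - p) ≤ p + (q - p) := by gcongr
      _ = q := by abel
  · intro hsub
    obtain ⟨v, hv, hve⟩ := hsub (show q - p ∈ below L q from ⟨hL, hpos, by simpa using hp⟩)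
    have : v = 0 := by simpa using hve
    exact not_pos_zero (this ▸ hv.2.1)

theorem eq_of_rank_eq {p q : ℝ × ℝ} (hp : 0 ≤ p) (hq : 0 ≤ q) (hL : q - p ∈ L)
    (h : rank L p = rank L q) : p = q := by
  rcases pos_trichotomy (q - p) with h' | h' | h'
  · exact absurd h (rank_lt_of_pos L hp hL h').ne
  · exact (sub_eq_zero.mp h').symm
  · rw [neg_sub] at h'
    have : p - q ∈ L := by simpa using neg_mem hL
    exact absurd h (rank_lt_of_pos L hq this h').ne'

theorem exists_pos_pos : ∃ v ∈ L, 0 < v.1 ∧ 0 < v.2 := by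
  obtain ⟨R, hR, h⟩ := exists_lattice_near L
  obtain ⟨v, hv, hd⟩ := h (2 * R, 2 * R)
  have h1 := (norm_fst_le _).trans hd
  have h2 := (norm_snd_le _).trans hd
  simp only [Prod.fst_sub, Prod.snd_sub, Real.norm_eq_abs, abs_le] at h1 h2
  exact ⟨v, hv, by linarith, by linarith⟩

theorem exists_large_rank (z : ℝ × ℝ) (k : ℕ) : ∃ q, 0 ≤ q ∧ q - z ∈ L ∧ k ≤ rank L q := by
  obtain ⟨v, hv, h1, h2⟩ := exists_pos_pos L
  have hvpos : Pos v := Or.inl (by linarith)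
  induction k with
  | zero =>
    obtain ⟨a, ha⟩ := exists_nat_ge (-z.1 / v.1)
    obtain ⟨b, hb⟩ := exists_nat_ge (-z.2 / v.2)
    rw [div_le_iff₀ h1] at ha
    rw [div_le_iff₀ h2] at hb
    have hn1 : (0 : ℝ) ≤ a * v.2 := by positivity
    have hn2 : (0 : ℝ) ≤ b * v.1 := by positivity
    refine ⟨z + (a + b) • v, ⟨?_, ?_⟩, ?_, Nat.zero_le _⟩
    · simp; linarith
    · simp; linarith
    · rw [add_sub_cancel_left]; exact L.smul_of_tower_mem _ hv
  | succ k ih =>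
    obtain ⟨q, hq, hqz, hk⟩ := ih
    have h0 : 0 ≤ v := ⟨h1.le, h2.le⟩
    refine ⟨q + v, add_nonneg hq h0, ?_, ?_⟩
    · rw [add_sub_right_comm]; exact add_mem hqz hv
    · have := rank_lt_of_pos L (q := q + v) hq (by simpa using hv) (by simpa using hvpos)
      omega

/-- Every rank is attained exactly once in the part of a coset in the quadrant. -/
theorem exists_rank_eq (z : ℝ × ℝ) (k : ℕ) : ∃ q, 0 ≤ q ∧ q - z ∈ L ∧ rank L q = k := by
  classical
  have hex : ∃ r, k ≤ r ∧ ∃ q, 0 ≤ q ∧ q - z ∈ L ∧ rank L q = r := by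
    obtain ⟨q, h1, h2, h3⟩ := exists_large_rank L z k
    exact ⟨_, h3, q, h1, h2, rfl⟩
  obtain ⟨hk, q, hq, hqz, hr⟩ := Nat.find_spec hex
  refine ⟨q, hq, hqz, le_antisymm ?_ (hr ▸ hk)⟩
  -- `q` has the least rank that is at least `k` in its coset. Its predecessors have smaller and
  -- distinct ranks, all below `k` by minimality, so there are at most `k` of them.
  have hmap : Set.MapsTo (fun v => rank L (q - v)) (below L q) (Finset.range k : Set ℕ) := by
    rintro v ⟨hv, hvp, hle⟩
    have hlt : rank L (q - v) < rank L q :=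
      rank_lt_of_pos L (sub_nonneg.mpr hle) (by simpa using hv) (by simpa using hvp)
    simp only [Finset.coe_range, Set.mem_Iio]
    by_contra hcon
    refine Nat.find_min hex (hr ▸ hlt) ⟨not_lt.mp hcon, q - v, sub_nonneg.mpr hle, ?_, rfl⟩
    rw [sub_right_comm]; exact sub_mem hqz hv
  have hinj : Set.InjOn (fun v => rank L (q - v)) (below L q) := by
    rintro v ⟨hv, hvp, hle⟩ w ⟨hw, hwp, hle'⟩ h
    have := eq_of_rank_eq L (sub_nonneg.mpr hle) (sub_nonneg.mpr hle')
      (by rw [sub_sub_sub_cancel_left]; exact sub_mem hv hw) h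
    simpa using this
  have := Set.ncard_le_ncard_of_injOn _ hmap hinj (Finset.finite_toSet _)
  rwa [Set.ncard_coe_finset, Finset.card_range] at this

/-- Every coset meets the staircase in exactly `j` points. -/
theorem encard_coset_stair (j : ℕ) (z : ℝ × ℝ) :
    {q | q ∈ stair L j ∧ q - z ∈ L}.encard = j := by
  have hinj : Set.InjOn (rank L) {q | q ∈ stair L j ∧ q - z ∈ L} := by
    rintro p ⟨hp, hpz⟩ q ⟨hq, hqz⟩ h
    refine eq_of_rank_eq L hp.1 hq.1 ?_ h
    have := sub_mem hqz hpz
    rwa [sub_sub_sub_cancel_right] at this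
  have himg : rank L '' {q | q ∈ stair L j ∧ q - z ∈ L} = (Finset.range j : Set ℕ) := by
    ext k
    simp only [Set.mem_image, Finset.coe_range, Set.mem_Iio]
    constructor
    · rintro ⟨q, ⟨hq, -⟩, rfl⟩; exact hq.2
    · intro hk
      obtain ⟨q, h1, h2, h3⟩ := exists_rank_eq L z k
      exact ⟨q, ⟨⟨h1, h3 ▸ hk⟩, h2⟩, h3⟩
  rw [← hinj.encard_image, himg, Set.encard_coe_eq_coe_finsetCard, Finset.card_range]

end

/-! ### Corners of the staircase: there are at most `2 j + 1`. -/

/-- The minimal points of the complement of the staircase in the quadrant. -/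
def IsCorner (L : Submodule ℤ (ℝ × ℝ)) (j : ℕ) (p : ℝ × ℝ) : Prop :=
  0 ≤ p ∧ j ≤ rank L p ∧ ∀ q, 0 ≤ q → q ≤ p → j ≤ rank L q → q = p

theorem IsCorner.eq_of_le {L : Submodule ℤ (ℝ × ℝ)} {j : ℕ} {p q : ℝ × ℝ} (hp : IsCorner L j p)
    (hq : IsCorner L j q) (h : q ≤ p) : q = p :=
  hp.2.2 q hq.1 h hq.2.1

theorem rank_zero (L : Submodule ℤ (ℝ × ℝ)) : rank L 0 = 0 := by
  have : below L 0 = ∅ := by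
    ext v
    simp only [Set.mem_empty_iff_false, iff_false]
    exact fun h => not_pos_of_nonpos h.2.2 h.2.1
  rw [rank, this, Set.ncard_empty]

section

variable (L : Submodule ℤ (ℝ × ℝ)) [DiscreteTopology L] [IsZLattice ℝ L]

/-- The quadrant is not well-founded, but it suffices to minimise over the finitely many joins `s W`
of `0` with a set `W` of at least `j` vectors of `below L p`: any `q ≤ p` in the quadrant with rank
at least `j` dominates the join of `below L q`. -/
theorem exists_corner_le {j : ℕ} {p : ℝ × ℝ} (hp : 0 ≤ p) (h : j ≤ rank L p) :
    ∃ m, IsCorner L j m ∧ m ≤ p := by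
  classical
  set B := (below_finite L p).toFinset with hB
  have hBc : ∀ W : Set (ℝ × ℝ), below L p = W → B.card = W.ncard := by
    rintro _ rfl; exact (Set.ncard_eq_toFinset_card _ _).symm
  let s : Finset (ℝ × ℝ) → ℝ × ℝ := fun W => (insert 0 W).sup' (Finset.insert_nonempty _ _) id
  have hs0 : ∀ W, 0 ≤ s W := fun W => Finset.le_sup' (f := id) (Finset.mem_insert_self _ _)
  have hsW : ∀ W, ∀ v ∈ W, v ≤ s W := fun W v hv =>
    Finset.le_sup' (f := id) (Finset.mem_insert_of_mem hv)
  have hsle : ∀ W q, 0 ≤ q → (∀ v ∈ W, v ≤ q) → s W ≤ q := by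
    intro W q hq hW
    refine Finset.sup'_le _ _ fun v hv => ?_
    rcases Finset.mem_insert.mp hv with rfl | hv
    · exact hq
    · exact hW v hv
  have hsr : ∀ W ⊆ B, j ≤ W.card → j ≤ rank L (s W) := by
    intro W hW hj
    refine hj.trans ?_
    rw [← Set.ncard_coe_finset]
    refine Set.ncard_le_ncard (fun v hv => ?_) (below_finite L _)
    have := hW hv
    rw [hB, Set.Finite.mem_toFinset] at this
    exact ⟨this.1, this.2.1, hsW W v hv⟩
  set F := (B.powerset.filter fun W => j ≤ W.card).image s with hF
  have hFne : F.Nonempty := by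
    refine ⟨s B, Finset.mem_image_of_mem _ ?_⟩
    rw [Finset.mem_filter]
    exact ⟨Finset.mem_powerset_self _, by rw [hBc _ rfl]; exact h⟩
  obtain ⟨m, hm⟩ := F.exists_minimal hFne
  obtain ⟨W, hW, rfl⟩ := Finset.mem_image.mp hm.1
  rw [Finset.mem_filter, Finset.mem_powerset] at hW
  have hWp : s W ≤ p := hsle W p hp fun v hv => by
    have := hW.1 hv
    rw [hB, Set.Finite.mem_toFinset] at this
    exact this.2.2
  refine ⟨s W, ⟨hs0 W, hsr W hW.1 hW.2, fun q hq hqm hjq => ?_⟩, hWp⟩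
  set Q := (below_finite L q).toFinset with hQ
  have hQB : Q ⊆ B := by
    rw [hQ, hB, Set.Finite.toFinset_subset_toFinset]
    exact below_mono L (hqm.trans hWp)
  have hsQ : s Q ≤ q := hsle Q q hq fun v hv => by
    rw [hQ, Set.Finite.mem_toFinset] at hv
    exact hv.2.2
  have hQF : s Q ∈ F := by
    refine Finset.mem_image_of_mem _ ?_
    rw [Finset.mem_filter, Finset.mem_powerset]
    refine ⟨hQB, ?_⟩
    rw [hQ, ← Set.ncard_eq_toFinset_card _ (below_finite L q)]; exact hjq
  exact le_antisymm hqm ((hm.2 hQF (hsQ.trans hqm)).trans hsQ)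

/-- The vectors of `below L p` that correspond to predecessors of `p` off the axis `f = 0`. -/
def offAxis (L : Submodule ℤ (ℝ × ℝ)) (f : ℝ × ℝ →+ ℝ) (p : ℝ × ℝ) : Set (ℝ × ℝ) :=
  {v | v ∈ below L p ∧ f v < f p}

/-- The vectors of `below L p` that correspond to predecessors of `p` with the same `f`. -/
def onAxis (L : Submodule ℤ (ℝ × ℝ)) (f : ℝ × ℝ →+ ℝ) (p : ℝ × ℝ) : Set (ℝ × ℝ) :=
  {v | v ∈ below L p ∧ f v = 0}

variable (f : ℝ × ℝ →+ ℝ)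

/-- The hypothesis `0 < f p` makes `q - p` itself an off-axis vector of `q`. Strict growth lets the
off-axis count identify a point off the axis within its coset. -/
theorem offAxis_ncard_lt {p q : ℝ × ℝ} (hp : 0 ≤ p) (hfp : 0 < f p) (hL : q - p ∈ L)
    (hpos : Pos (q - p)) : (offAxis L f p).ncard < (offAxis L f q).ncard := by
  have hinj : Function.Injective (fun v : ℝ × ℝ => v + (q - p)) := add_left_injective _
  rw [← Set.ncard_image_of_injective (offAxis L f p) hinj]
  refine Set.ncard_lt_ncard ⟨?_, ?_⟩ ((below_finite L q).subset fun _ h => h.1)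
  · rintro _ ⟨v, ⟨⟨hv, hvp, hle⟩, hf⟩, rfl⟩
    refine ⟨⟨add_mem hv hL, hvp.add hpos, ?_⟩, ?_⟩
    · calc v + (q - p) ≤ p + (q - p) := by gcongr
        _ = q := by abel
    · simp only [map_add, map_sub]; linarith
  · intro hsub
    obtain ⟨v, hv, hve⟩ := hsub (show q - p ∈ offAxis L f q from
      ⟨⟨hL, hpos, by simpa using hp⟩, by rw [map_sub]; linarith⟩)
    have : v = 0 := by simpa using hve
    exact not_pos_zero (this ▸ hv.1.2.1)

theorem onAxis_ncard_lt {p q : ℝ × ℝ} (hp : 0 ≤ p) (hf : f p = f q) (hL : q - p ∈ L)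
    (hpos : Pos (q - p)) : (onAxis L f p).ncard < (onAxis L f q).ncard := by
  have hinj : Function.Injective (fun v : ℝ × ℝ => v + (q - p)) := add_left_injective _
  rw [← Set.ncard_image_of_injective (onAxis L f p) hinj]
  refine Set.ncard_lt_ncard ⟨?_, ?_⟩ ((below_finite L q).subset fun _ h => h.1)
  · rintro _ ⟨v, ⟨⟨hv, hvp, hle⟩, hf⟩, rfl⟩
    refine ⟨⟨add_mem hv hL, hvp.add hpos, ?_⟩, ?_⟩
    · calc v + (q - p) ≤ p + (q - p) := by gcongr
        _ = q := by abel
    · simp only [map_add, map_sub]; linarith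
  · intro hsub
    obtain ⟨v, hv, hve⟩ := hsub (show q - p ∈ onAxis L f q from
      ⟨⟨hL, hpos, by simpa using hp⟩, by rw [map_sub]; linarith⟩)
    have : v = 0 := by simpa using hve
    exact not_pos_zero (this ▸ hv.1.2.1)

/-- If `p` has at least `j` predecessors, but fewer than `j` off the axis `f = 0`, then one of its
predecessors on this axis is the `j`-th one when those off the axis are counted first. -/
theorem exists_axis_point (hf : Monotone f) {j : ℕ} {p : ℝ × ℝ} (hj : j ≤ rank L p)
    (hoff : (offAxis L f p).ncard < j) :
    ∃ v ∈ below L p, f v = f p ∧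
      (onAxis L f (p - v)).ncard + (offAxis L f p).ncard + 1 = j ∧ rank L (p - v) < j := by
  classical
  have hfin := below_finite L p
  set Y : Set (ℝ × ℝ) := {v | v ∈ below L p ∧ f v = f p} with hY
  have hYfin : Y.Finite := hfin.subset fun _ h => h.1
  have hofffin : (offAxis L f p).Finite := hfin.subset fun _ h => h.1
  have hcard : rank L p ≤ (offAxis L f p).ncard + Y.ncard := by
    refine le_trans (Set.ncard_le_ncard (fun v hv => ?_) (hofffin.union hYfin))
      (Set.ncard_union_le _ _)
    rcases (hf hv.2.2).lt_or_eq with h | h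
    · exact Or.inl ⟨hv, h⟩
    · exact Or.inr ⟨hv, h⟩
  have hinj : Set.InjOn (fun w => (onAxis L f (p - w)).ncard) Y := by
    rintro v ⟨⟨hv, hvp, hle⟩, hvf⟩ w ⟨⟨hw, hwp, hle'⟩, hwf⟩ h
    have hv0 := sub_nonneg.mpr hle
    have hw0 := sub_nonneg.mpr hle'
    rcases pos_trichotomy (v - w) with h' | h' | h'
    · refine absurd h (onAxis_ncard_lt L f hv0 ?_ ?_ ?_).ne
      · simp [hvf, hwf]
      · rw [sub_sub_sub_cancel_left]; exact sub_mem hv hw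
      · rwa [sub_sub_sub_cancel_left]
    · exact sub_eq_zero.mp h'
    · refine absurd h (onAxis_ncard_lt L f hw0 ?_ ?_ ?_).ne'
      · simp [hvf, hwf]
      · rw [sub_sub_sub_cancel_left]; exact sub_mem hw hv
      · rw [sub_sub_sub_cancel_left]; rwa [neg_sub] at h'
  -- With the off-axis points counted first, the `j`-th predecessor is the axis point that has `t`
  -- predecessors on the axis.
  obtain ⟨t, ht⟩ : ∃ t, j = t + (offAxis L f p).ncard + 1 :=
    ⟨j - (offAxis L f p).ncard - 1, by omega⟩
  -- `Y` has more than `t` elements, with distinct on-axis counts, so some count is at least `t`.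
  -- The least such count equals `t`, as the axis points it counts have distinct smaller counts, all
  -- below `t`.
  have hex : ∃ r, t ≤ r ∧ ∃ v ∈ Y, (onAxis L f (p - v)).ncard = r := by
    by_contra! hcon
    have hmap : Set.MapsTo (fun w => (onAxis L f (p - w)).ncard) Y (Finset.range t : Set ℕ) := by
      intro w hw
      simp only [Finset.coe_range, Set.mem_Iio]
      by_contra h
      exact hcon _ (not_lt.mp h) w hw rfl
    have := Set.ncard_le_ncard_of_injOn _ hmap hinj (Finset.finite_toSet _)
    rw [Set.ncard_coe_finset, Finset.card_range] at this
    omega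
  obtain ⟨hk, v, ⟨⟨hv, hvp, hle⟩, hvf⟩, hr⟩ := Nat.find_spec hex
  have hmem : ∀ u ∈ below L (p - v), u + v ∈ below L p := fun u hu =>
    ⟨add_mem hu.1 hv, hu.2.1.add hvp, by
      have := hu.2.2
      rwa [le_sub_iff_add_le] at this⟩
  have hle_t : (onAxis L f (p - v)).ncard ≤ t := by
    have hmap : Set.MapsTo (fun u => (onAxis L f (p - (u + v))).ncard) (onAxis L f (p - v))
        (Finset.range t : Set ℕ) := by
      rintro u ⟨hu, hu0⟩
      have huY : u + v ∈ Y := ⟨hmem u hu, by rw [map_add, hu0, hvf, zero_add]⟩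
      have hlt : (onAxis L f (p - (u + v))).ncard < (onAxis L f (p - v)).ncard := by
        refine onAxis_ncard_lt L f (sub_nonneg.mpr huY.1.2.2) ?_ ?_ ?_
        · simp [hu0]
        · rw [sub_sub_sub_cancel_left, add_sub_cancel_right]; exact hu.1
        · rw [sub_sub_sub_cancel_left, add_sub_cancel_right]; exact hu.2.1
      simp only [Finset.coe_range, Set.mem_Iio]
      by_contra hcon
      exact Nat.find_min hex (hr ▸ hlt) ⟨not_lt.mp hcon, u + v, huY, rfl⟩
    have hinj' : Set.InjOn (fun u => (onAxis L f (p - (u + v))).ncard) (onAxis L f (p - v)) := by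
      rintro u ⟨hu, hu0⟩ w ⟨hw, hw0⟩ h
      have := hinj (x₁ := u + v) (x₂ := w + v) ⟨hmem u hu, by rw [map_add, hu0, hvf, zero_add]⟩
        ⟨hmem w hw, by rw [map_add, hw0, hvf, zero_add]⟩ h
      exact add_right_cancel this
    have := Set.ncard_le_ncard_of_injOn _ hmap hinj' (Finset.finite_toSet _)
    rwa [Set.ncard_coe_finset, Finset.card_range] at this
  refine ⟨v, ⟨hv, hvp, hle⟩, hvf, by omega, ?_⟩
  -- A predecessor of the axis point `p - v` is either on the axis or an off-axis predecessor of
  -- `p`.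
  have hrank : rank L (p - v) ≤ (onAxis L f (p - v)).ncard + (offAxis L f p).ncard := by
    have hf1 : (onAxis L f (p - v)).Finite := (below_finite L _).subset fun _ h => h.1
    have hinja : Function.Injective (fun u : ℝ × ℝ => u + v) := add_left_injective _
    have hf2 : ((fun u : ℝ × ℝ => u + v) ⁻¹' offAxis L f p).Finite :=
      hofffin.preimage hinja.injOn
    have h2 : ((fun u : ℝ × ℝ => u + v) ⁻¹' offAxis L f p).ncard ≤ (offAxis L f p).ncard := by
      rw [← Set.ncard_image_of_injective _ hinja]
      exact Set.ncard_le_ncard (Set.image_preimage_subset _ _) hofffin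
    refine le_trans (Set.ncard_le_ncard (t := onAxis L f (p - v) ∪
      (fun u : ℝ × ℝ => u + v) ⁻¹' offAxis L f p) (fun u hu => ?_) (hf1.union hf2))
      ((Set.ncard_union_le _ _).trans (by omega))
    have hfu := hf hu.2.2
    rw [map_sub, hvf, sub_self] at hfu
    rcases hfu.lt_or_eq with h | h
    · exact Or.inr ⟨hmem u hu, by rw [map_add, hvf]; linarith⟩
    · exact Or.inl ⟨hu, h⟩
  omega

/-- Moving `p` left to the largest first coordinate among `0` and its off-axis vectors keeps all of
these below it. With `j` of them, the moved point would contradict the minimality of `p`. -/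
theorem IsCorner.offAxis_fst {j : ℕ} {p : ℝ × ℝ} (hp : IsCorner L j p) (h : 0 < p.1) :
    (offAxis L (AddMonoidHom.fst ℝ ℝ) p).ncard < j := by
  have hfin : (offAxis L (AddMonoidHom.fst ℝ ℝ) p).Finite :=
    (below_finite L p).subset fun _ h => h.1
  obtain ⟨c, hc, hmax⟩ := Set.exists_max_image (insert 0 (offAxis L (AddMonoidHom.fst ℝ ℝ) p))
    Prod.fst (hfin.insert 0) (Set.insert_nonempty _ _)
  have h0 : 0 ≤ c.1 := hmax 0 (Set.mem_insert _ _)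
  have hlt : c.1 < p.1 := by
    rcases hc with rfl | hc
    · exact h
    · exact hc.2
  by_contra! hcon
  have := hp.2.2 (c.1, p.2) ⟨h0, hp.1.2⟩ ⟨hlt.le, le_rfl⟩
    (hcon.trans (Set.ncard_le_ncard (fun v hv => ⟨hv.1.1, hv.1.2.1,
      ⟨hmax v (Set.mem_insert_of_mem _ hv), hv.1.2.2.2⟩⟩) (below_finite L _)))
  exact hlt.ne (Prod.ext_iff.mp this).1

theorem IsCorner.offAxis_snd {j : ℕ} {p : ℝ × ℝ} (hp : IsCorner L j p) (h : 0 < p.2) :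
    (offAxis L (AddMonoidHom.snd ℝ ℝ) p).ncard < j := by
  have hfin : (offAxis L (AddMonoidHom.snd ℝ ℝ) p).Finite :=
    (below_finite L p).subset fun _ h => h.1
  obtain ⟨c, hc, hmax⟩ := Set.exists_max_image (insert 0 (offAxis L (AddMonoidHom.snd ℝ ℝ) p))
    Prod.snd (hfin.insert 0) (Set.insert_nonempty _ _)
  have h0 : 0 ≤ c.2 := hmax 0 (Set.mem_insert _ _)
  have hlt : c.2 < p.2 := by
    rcases hc with rfl | hc
    · exact h
    · exact hc.2
  by_contra! hcon
  have := hp.2.2 (p.1, c.2) ⟨hp.1.1, h0⟩ ⟨le_rfl, hlt.le⟩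
    (hcon.trans (Set.ncard_le_ncard (fun v hv => ⟨hv.1.1, hv.1.2.1,
      ⟨hv.1.2.2.1, hmax v (Set.mem_insert_of_mem _ hv)⟩⟩) (below_finite L _)))
  exact hlt.ne (Prod.ext_iff.mp this).2

theorem finite_and_ncard_le_of_finset_card_le {α : Type*} {S : Set α} {k : ℕ}
    (h : ∀ F : Finset α, (F : Set α) ⊆ S → F.card ≤ k) : S.Finite ∧ S.ncard ≤ k := by
  have hfin : S.Finite := by
    by_contra hinf
    obtain ⟨F, hF, hc⟩ := Set.Infinite.exists_subset_card_eq hinf (k + 1)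
    have := h F hF
    omega
  refine ⟨hfin, ?_⟩
  have := h hfin.toFinset (by simp)
  rwa [← Set.ncard_eq_toFinset_card _ hfin] at this

/-- If `u` is the highest of finitely many such vectors, all of them lie in `below L (0, u.2)`,
which has fewer than `j` elements. -/
theorem axis_vectors_fst {j : ℕ} (hj : 1 ≤ j) :
    {u | u ∈ L ∧ Pos u ∧ u.1 ≤ 0 ∧ rank L (0, u.2) < j}.Finite ∧
    {u | u ∈ L ∧ Pos u ∧ u.1 ≤ 0 ∧ rank L (0, u.2) < j}.ncard ≤ j - 1 := by
  refine finite_and_ncard_le_of_finset_card_le fun F hF => ?_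
  rcases F.eq_empty_or_nonempty with rfl | hne
  · simp
  obtain ⟨c, hc, hmax⟩ := F.exists_max_image Prod.snd hne
  have hlt := (hF hc).2.2.2
  have : F.card ≤ rank L (0, c.2) := by
    rw [← Set.ncard_coe_finset]
    exact Set.ncard_le_ncard (fun v hv => ⟨(hF hv).1, (hF hv).2.1, (hF hv).2.2.1, hmax v hv⟩)
      (below_finite L _)
  omega

theorem axis_vectors_snd {j : ℕ} (hj : 1 ≤ j) :
    {u | u ∈ L ∧ Pos u ∧ u.2 ≤ 0 ∧ rank L (u.1, 0) < j}.Finite ∧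
    {u | u ∈ L ∧ Pos u ∧ u.2 ≤ 0 ∧ rank L (u.1, 0) < j}.ncard ≤ j - 1 := by
  refine finite_and_ncard_le_of_finset_card_le fun F hF => ?_
  rcases F.eq_empty_or_nonempty with rfl | hne
  · simp
  obtain ⟨c, hc, hmax⟩ := F.exists_max_image Prod.fst hne
  have hlt := (hF hc).2.2.2
  have : F.card ≤ rank L (c.1, 0) := by
    rw [← Set.ncard_coe_finset]
    exact Set.ncard_le_ncard (fun v hv => ⟨(hF hv).1, (hF hv).2.1, hmax v hv, (hF hv).2.2.1⟩)
      (below_finite L _)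
  omega

/-- There are at most `2 j - 1` corners off the axes. -/
theorem interior_corners {j : ℕ} (hj : 1 ≤ j) :
    {p | IsCorner L j p ∧ 0 < p.1 ∧ 0 < p.2}.Finite ∧
    {p | IsCorner L j p ∧ 0 < p.1 ∧ 0 < p.2}.ncard ≤ 2 * j - 1 := by
  -- The corner `p` selects one point of its coset on each axis by `exists_axis_point`; `u` is their
  -- difference. Its coordinates are, up to sign, the positions of the two points, so `u` recovers
  -- both.
  have key : ∀ p, ∃ u, IsCorner L j p ∧ 0 < p.1 ∧ 0 < p.2 → u ∈ L ∧ u.1 ≤ 0 ∧ 0 ≤ u.2 ∧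
      rank L (0, u.2) < j ∧ rank L (-u.1, 0) < j ∧ (0, u.2) - p ∈ L ∧
      (onAxis L (AddMonoidHom.fst ℝ ℝ) (0, u.2)).ncard +
        (offAxis L (AddMonoidHom.fst ℝ ℝ) p).ncard + 1 = j := by
    intro p
    by_cases hp : IsCorner L j p ∧ 0 < p.1 ∧ 0 < p.2
    · obtain ⟨hc, h1, h2⟩ := hp
      obtain ⟨v, hv, hv1, hvj, hvr⟩ := exists_axis_point L (AddMonoidHom.fst ℝ ℝ)
        (fun a b h => h.1) hc.2.1 (hc.offAxis_fst L h1)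
      obtain ⟨w, hw, hw2, -, hwr⟩ := exists_axis_point L (AddMonoidHom.snd ℝ ℝ)
        (fun a b h => h.2) hc.2.1 (hc.offAxis_snd L h2)
      simp only [AddMonoidHom.coe_fst, AddMonoidHom.coe_snd] at hv1 hw2
      have ha : p - v = (0, (w - v).2) := by
        ext <;> simp [hv1, hw2]
      have hb : p - w = (-(w - v).1, 0) := by
        ext <;> simp [hv1, hw2]
      refine ⟨w - v, fun _ => ⟨sub_mem hw.1 hv.1, ?_, ?_, ?_, ?_, ?_, ?_⟩⟩
      · have := hw.2.2.1
        simp only [Prod.fst_sub]; linarith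
      · have := hv.2.2.2
        simp only [Prod.snd_sub]; linarith
      · rwa [← ha]
      · rwa [← hb]
      · rw [← ha]; simpa using hv.1
      · rwa [← ha]
    · exact ⟨0, fun h => absurd h hp⟩
  choose Φ hΦ using key
  set U1 := {u | u ∈ L ∧ Pos u ∧ u.1 ≤ 0 ∧ rank L (0, u.2) < j}
  set U2 := {u | u ∈ L ∧ Pos u ∧ u.2 ≤ 0 ∧ rank L (u.1, 0) < j}
  obtain ⟨hf1, hc1⟩ : U1.Finite ∧ U1.ncard ≤ j - 1 := axis_vectors_fst L hj
  obtain ⟨hf2, hc2⟩ : U2.Finite ∧ U2.ncard ≤ j - 1 := axis_vectors_snd L hj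
  -- The bound is `1 + (j - 1) + (j - 1)`: the difference is zero, positive or negative, and the
  -- last two cases fall under the two lemmas on axis vectors.
  have hmap : Set.MapsTo Φ {p | IsCorner L j p ∧ 0 < p.1 ∧ 0 < p.2}
      (insert 0 (U1 ∪ Neg.neg '' U2)) := by
    intro p hp
    obtain ⟨hL, h1, h2, h3, h4, -, -⟩ := hΦ p hp
    rcases pos_trichotomy (Φ p) with h | h | h
    · exact Or.inr (Or.inl ⟨hL, h, h1, h3⟩)
    · exact Or.inl h
    · refine Or.inr (Or.inr ⟨-Φ p, ⟨neg_mem hL, h, ?_, h4⟩, neg_neg _⟩)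
      simpa using h2
  -- The difference fixes the point on the vertical axis, hence the coset of `p` and the on-axis
  -- count; since the two counts add up to `j - 1`, the off-axis count is fixed too, and it
  -- determines `p`.
  have hinj : Set.InjOn Φ {p | IsCorner L j p ∧ 0 < p.1 ∧ 0 < p.2} := by
    intro p hp q hq h
    obtain ⟨-, -, -, -, -, h6, h7⟩ := hΦ p hp
    obtain ⟨-, -, -, -, -, h6', h7'⟩ := hΦ q hq
    rw [h] at h6 h7
    have hpq : q - p ∈ L := by
      have := sub_mem h6 h6'
      rwa [sub_sub_sub_cancel_left] at this
    rcases pos_trichotomy (q - p) with h' | h' | h'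
    · have := offAxis_ncard_lt L (AddMonoidHom.fst ℝ ℝ) hp.1.1 hp.2.1 hpq h'
      omega
    · exact (sub_eq_zero.mp h').symm
    · rw [neg_sub] at h'
      have := offAxis_ncard_lt L (AddMonoidHom.fst ℝ ℝ) hq.1.1 hq.2.1
        (by simpa using neg_mem hpq) h'
      omega
  have hfin : (insert 0 (U1 ∪ Neg.neg '' U2)).Finite := (hf1.union (hf2.image _)).insert _
  refine ⟨Set.Finite.of_injOn hmap hinj hfin, ?_⟩
  refine (Set.ncard_le_ncard_of_injOn _ hmap hinj hfin).trans ?_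
  refine (Set.ncard_insert_le _ _).trans ?_
  have := Set.ncard_union_le U1 (Neg.neg '' U2)
  have := Set.ncard_image_le (f := Neg.neg) hf2
  omega

theorem exists_rank_le_of_pos {j : ℕ} {v q : ℝ × ℝ} (hv : v ∈ L) (hpos : Pos v)
    (h : ∀ k : ℕ, 1 ≤ k → k ≤ j → (k : ℕ) • v ≤ q) : j ≤ rank L q := by
  have hv0 : v ≠ 0 := fun h => not_pos_zero (h ▸ hpos)
  have hinj : Function.Injective (fun k : ℕ => k • v) := by
    intro a b hab
    have h1 := congrArg Prod.fst hab
    have h2 := congrArg Prod.snd hab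
    simp only [Prod.smul_fst] at h1
    simp only [Prod.smul_snd] at h2
    rw [nsmul_eq_mul, nsmul_eq_mul] at h1 h2
    by_contra hne
    have hne' : (a : ℝ) - b ≠ 0 := sub_ne_zero.mpr (by exact_mod_cast hne)
    apply hv0
    ext
    · exact (mul_eq_zero.mp (show ((a : ℝ) - b) * v.1 = 0 by linarith)).resolve_left hne'
    · exact (mul_eq_zero.mp (show ((a : ℝ) - b) * v.2 = 0 by linarith)).resolve_left hne'
  have hposk : ∀ k : ℕ, 1 ≤ k → Pos (k • v) := by
    intro k hk
    induction k, hk using Nat.le_induction with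
    | base => simpa using hpos
    | succ k _ ih => rw [succ_nsmul]; exact ih.add hpos
  calc j = ((fun k : ℕ => k • v) '' (Finset.Icc 1 j : Set ℕ)).ncard := by
        rw [Set.ncard_image_of_injective _ hinj, Set.ncard_coe_finset]; simp
    _ ≤ rank L q := by
        refine Set.ncard_le_ncard ?_ (below_finite L q)
        rintro _ ⟨k, hk, rfl⟩
        rw [Finset.mem_coe, Finset.mem_Icc] at hk
        exact ⟨L.smul_of_tower_mem _ hv, hposk k hk.1, h k hk.1 hk.2⟩

theorem exists_axis_rank (j : ℕ) :
    (∃ y : ℝ, 0 ≤ y ∧ j ≤ rank L (0, y)) ∧ (∃ x : ℝ, 0 ≤ x ∧ j ≤ rank L (x, 0)) := by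
  obtain ⟨R, hR, h⟩ := exists_lattice_near L
  constructor
  -- Any vector within `R` of this point has negative first coordinate and coordinate sum at least
  -- `R`, so its multiples are positive and lie below points of the vertical axis.
  · obtain ⟨v, hv, hd⟩ := h (-2 * R, 5 * R)
    have h1 := (norm_fst_le _).trans hd
    have h2 := (norm_snd_le _).trans hd
    simp only [Prod.fst_sub, Prod.snd_sub, Real.norm_eq_abs, abs_le] at h1 h2
    refine ⟨j * v.2, mul_nonneg (by positivity) (by linarith),
      exists_rank_le_of_pos L hv (Or.inl (by linarith)) fun k _ hk => ⟨?_, ?_⟩⟩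
    · rw [Prod.smul_fst, nsmul_eq_mul]
      exact mul_nonpos_of_nonneg_of_nonpos (by positivity) (by linarith)
    · rw [Prod.smul_snd, nsmul_eq_mul]
      exact mul_le_mul_of_nonneg_right (by exact_mod_cast hk) (by linarith)
  · obtain ⟨v, hv, hd⟩ := h (5 * R, -2 * R)
    have h1 := (norm_fst_le _).trans hd
    have h2 := (norm_snd_le _).trans hd
    simp only [Prod.fst_sub, Prod.snd_sub, Real.norm_eq_abs, abs_le] at h1 h2
    refine ⟨j * v.1, mul_nonneg (by positivity) (by linarith),
      exists_rank_le_of_pos L hv (Or.inl (by linarith)) fun k _ hk => ⟨?_, ?_⟩⟩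
    · rw [Prod.smul_fst, nsmul_eq_mul]
      exact mul_le_mul_of_nonneg_right (by exact_mod_cast hk) (by linarith)
    · rw [Prod.smul_snd, nsmul_eq_mul]
      exact mul_nonpos_of_nonneg_of_nonpos (by positivity) (by linarith)

/-- The complement of the staircase in the quadrant is generated by at most `2 j + 1` points,
one of them on each axis. -/
theorem exists_corners {j : ℕ} (hj : 1 ≤ j) :
    ∃ (M : Finset (ℝ × ℝ)) (α β : ℝ), M.card ≤ 2 * j + 1 ∧ 0 < α ∧ 0 < β ∧ (0, α) ∈ M ∧
      (β, 0) ∈ M ∧ (∀ m ∈ M, 0 ≤ m ∧ j ≤ rank L m ∧ m.1 ≤ β ∧ (m.1 < β → 0 < m.2)) ∧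
      ∀ p, 0 ≤ p → j ≤ rank L p → ∃ m ∈ M, m ≤ p := by
  classical
  obtain ⟨⟨y, hy, hyr⟩, ⟨x, hx, hxr⟩⟩ := exists_axis_rank L j
  obtain ⟨a, ha, hay⟩ := exists_corner_le L (p := (0, y)) ⟨le_rfl, hy⟩ hyr
  obtain ⟨b, hb, hbx⟩ := exists_corner_le L (p := (x, 0)) ⟨hx, le_rfl⟩ hxr
  have ha1 : a.1 = 0 := le_antisymm hay.1 ha.1.1
  have hb2 : b.2 = 0 := le_antisymm hbx.2 hb.1.2
  have hne0 : ∀ c, IsCorner L j c → c ≠ 0 := by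
    rintro _ hc rfl
    have := hc.2.1
    rw [rank_zero] at this
    omega
  have ha2 : 0 < a.2 := lt_of_le_of_ne ha.1.2 fun h => hne0 a ha (Prod.ext ha1 h.symm)
  have hb1 : 0 < b.1 := lt_of_le_of_ne hb.1.1 fun h => hne0 b hb (Prod.ext h.symm hb2)
  have hae : a = (0, a.2) := Prod.ext ha1 rfl
  have hbe : b = (b.1, 0) := Prod.ext rfl hb2
  obtain ⟨hfin, hcard⟩ := interior_corners L hj
  -- Two corners on the same axis are comparable, hence equal.
  have hM : ∀ c, IsCorner L j c ↔ c ∈ insert a (insert b hfin.toFinset) := by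
    intro c
    simp only [Finset.mem_insert, Set.Finite.mem_toFinset]
    constructor
    · intro hc
      rcases hc.1.1.eq_or_lt with h1 | h1
      · left
        have h1 : c.1 = 0 := h1.symm
        rcases le_total c.2 a.2 with h | h
        · exact ha.eq_of_le hc ⟨by rw [h1, ha1], h⟩
        · exact (hc.eq_of_le ha ⟨by rw [h1, ha1], h⟩).symm
      right
      rcases hc.1.2.eq_or_lt with h2 | h2
      · left
        have h2 : c.2 = 0 := h2.symm
        rcases le_total c.1 b.1 with h | h
        · exact hb.eq_of_le hc ⟨h, by rw [h2, hb2]⟩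
        · exact (hc.eq_of_le hb ⟨h, by rw [h2, hb2]⟩).symm
      · exact Or.inr ⟨hc, h1, h2⟩
    · rintro (rfl | rfl | h)
      · exact ha
      · exact hb
      · exact h.1
  refine ⟨insert a (insert b hfin.toFinset), a.2, b.1, ?_, ha2, hb1, ?_, ?_, ?_, ?_⟩
  · have h1 := Finset.card_insert_le a (insert b hfin.toFinset)
    have h2 := Finset.card_insert_le b hfin.toFinset
    rw [Set.ncard_eq_toFinset_card _ hfin] at hcard
    omega
  · rw [← hae, ← hM]; exact ha
  · rw [← hbe, ← hM]; exact hb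
  · intro m hm
    rw [← hM] at hm
    refine ⟨hm.1, hm.2.1, ?_, ?_⟩
    · by_contra! hlt
      have := hm.eq_of_le hb ⟨hlt.le, by rw [hb2]; exact hm.1.2⟩
      exact hlt.ne (congrArg Prod.fst this)
    · intro hlt
      refine lt_of_le_of_ne hm.1.2 fun h => ?_
      have := hb.eq_of_le hm ⟨hlt.le, by rw [hb2]; exact h.ge⟩
      exact hlt.ne (congrArg Prod.fst this)
  · intro p hp hr
    obtain ⟨m, hm, hmp⟩ := exists_corner_le L hp hr
    exact ⟨m, (hM m).mp hm, hmp⟩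

end

/-! ### Step functions, area, and the two extremal problems. -/

/-- The staircase polygon with unit steps. -/
def unitStair (j : ℕ) : Set (ℝ × ℝ) :=
  {p | ∃ i : ℕ, i < 2 * j ∧ (i : ℝ) ≤ p.1 ∧ p.1 < i + 1 ∧ 0 ≤ p.2 ∧ p.2 < 2 * j - i}

/-- The open right triangle with legs `s` on the axes. -/
def openTriangle (s : ℝ) : Set (ℝ × ℝ) := {p | 0 < p.1 ∧ 0 < p.2 ∧ p.1 + p.2 < s}

/-- The closed right triangle with legs `s` on the axes. -/
def closedTriangle (s : ℝ) : Set (ℝ × ℝ) := {p | 0 ≤ p.1 ∧ 0 ≤ p.2 ∧ p.1 + p.2 ≤ s}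

section

variable (L : Submodule ℤ (ℝ × ℝ)) [DiscreteTopology L] [IsZLattice ℝ L]

/-- The staircase of a lattice is a staircase polygon with at most `2 j` steps. -/
theorem exists_steps {j : ℕ} (hj : 1 ≤ j) :
    ∃ x y : ℕ → ℝ, Monotone x ∧ x 0 = 0 ∧ (∀ i, 0 ≤ y i ∧ j ≤ rank L (x i, y i)) ∧
      (∀ i, x i < x (i + 1) → 0 < y i) ∧ y (2 * j) = 0 ∧
      stair L j = {p | ∃ i < 2 * j, x i ≤ p.1 ∧ p.1 < x (i + 1) ∧ 0 ≤ p.2 ∧ p.2 < y i} := by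
  classical
  obtain ⟨M, α, β, hcard, hα, hβ, hαM, hβM, hM, hgen⟩ := exists_corners L hj
  have hXne : (M.image Prod.fst).Nonempty := ⟨_, Finset.mem_image_of_mem _ hαM⟩
  obtain ⟨k, hk⟩ : ∃ k, (M.image Prod.fst).card = k + 1 :=
    ⟨(M.image Prod.fst).card - 1, by have := hXne.card_pos; omega⟩
  have hk2 : k ≤ 2 * j := by
    have := Finset.card_image_le (s := M) (f := Prod.fst)
    omega
  let e := (M.image Prod.fst).orderEmbOfFin hk
  have hlt : ∀ i, min i k < k + 1 := fun i => by omega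
  -- Capping the index repeats the last abscissa, so that missing steps become steps of width zero.
  let x : ℕ → ℝ := fun i => e ⟨min i k, hlt i⟩
  have hx : Monotone x := by
    intro a b hab
    refine e.monotone ?_
    rw [Fin.mk_le_mk]
    omega
  have hxM : ∀ i, ∃ m ∈ M, m.1 = x i := fun i => by
    have := Finset.orderEmbOfFin_mem (M.image Prod.fst) hk ⟨min i k, hlt i⟩
    exact Finset.mem_image.mp this
  have hMx : ∀ m ∈ M, ∃ i ≤ 2 * j, x i = m.1 := by
    intro m hm
    have : m.1 ∈ Set.range e := by
      rw [Finset.range_orderEmbOfFin]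
      exact Finset.mem_coe.mpr (Finset.mem_image_of_mem _ hm)
    obtain ⟨i, hi⟩ := this
    refine ⟨i, by omega, ?_⟩
    rw [← hi]
    have : min (i : ℕ) k = i := by omega
    simp only [x, this]
  have hx0 : x 0 = 0 := by
    apply le_antisymm
    · obtain ⟨i, -, hi⟩ := hMx _ hαM
      have := hx (Nat.zero_le i)
      rw [hi] at this
      exact this
    · obtain ⟨m, hm, hmx⟩ := hxM 0
      rw [← hmx]; exact (hM m hm).1.1
  have hxβ : ∀ i, x i ≤ β := fun i => by
    obtain ⟨m, hm, hmx⟩ := hxM i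
    rw [← hmx]; exact (hM m hm).2.2.1
  have hβx : β ≤ x (2 * j) := by
    obtain ⟨i, hi, hie⟩ := hMx _ hβM
    have := hx hi
    rwa [hie] at this
  -- The height over `[x i, x (i + 1))` is that of the lowest corner with abscissa at most `x i`.
  have hmin : ∀ i, ∃ m ∈ M, m.1 ≤ x i ∧ ∀ m' ∈ M, m'.1 ≤ x i → m.2 ≤ m'.2 := by
    intro i
    have hne : (M.filter fun m => m.1 ≤ x i).Nonempty :=
      ⟨_, Finset.mem_filter.mpr ⟨hαM, by rw [← hx0]; exact hx (Nat.zero_le i)⟩⟩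
    obtain ⟨m, hm, hmm⟩ := Finset.exists_min_image _ Prod.snd hne
    rw [Finset.mem_filter] at hm
    exact ⟨m, hm.1, hm.2, fun m' h h' => hmm m' (Finset.mem_filter.mpr ⟨h, h'⟩)⟩
  choose m hmM hmx hmm using hmin
  refine ⟨x, fun i => (m i).2, hx, hx0, fun i => ⟨(hM _ (hmM i)).1.2, ?_⟩, ?_, ?_, ?_⟩
  · exact (hM _ (hmM i)).2.1.trans (rank_mono L ⟨hmx i, le_rfl⟩)
  · intro i hi
    exact (hM _ (hmM i)).2.2.2 ((hmx i).trans_lt (hi.trans_le (hxβ _)))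
  · exact le_antisymm (hmm _ _ hβM hβx) (hM _ (hmM _)).1.2
  · ext p
    constructor
    · rintro ⟨hp, hr⟩
      have hpβ : p.1 < x (2 * j) := by
        by_contra! hcon
        have := rank_mono L (p := (β, 0)) (q := p) ⟨(hxβ _ |>.antisymm hβx).ge.trans hcon, hp.2⟩
        exact absurd (((hM _ hβM).2.1.trans this)) (not_le.mpr hr)
      have hex : ∃ i, p.1 < x i := ⟨_, hpβ⟩
      have hle : Nat.find hex ≤ 2 * j := Nat.find_min' hex hpβ
      have hne : Nat.find hex ≠ 0 := by
        intro h0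
        have := Nat.find_spec hex
        rw [h0, hx0] at this
        exact absurd hp.1 (not_le.mpr this)
      obtain ⟨i, hi⟩ := Nat.exists_eq_succ_of_ne_zero hne
      have hi1 : p.1 < x (i + 1) := by
        have := Nat.find_spec hex
        rwa [hi] at this
      have hi2 : x i ≤ p.1 := not_lt.mp (Nat.find_min hex (by omega))
      refine ⟨i, by omega, hi2, hi1, hp.2, ?_⟩
      by_contra! hcon
      have := rank_mono L (p := m i) (q := p) ⟨(hmx i).trans hi2, hcon⟩
      exact absurd ((hM _ (hmM i)).2.1.trans this) (not_le.mpr hr)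
    · rintro ⟨i, hi, h1, h2, h3, h4⟩
      have hp : 0 ≤ p := ⟨by
        have := hx (Nat.zero_le i)
        rw [hx0] at this
        exact this.trans h1, h3⟩
      refine ⟨hp, ?_⟩
      by_contra! hcon
      obtain ⟨c, hc, hcp⟩ := hgen p hp hcon
      obtain ⟨l, -, hl⟩ := hMx c hc
      have hli : l ≤ i := by
        by_contra! h
        have := hx (Nat.succ_le_of_lt h)
        rw [hl] at this
        exact absurd (hcp.1.trans_lt h2) (not_lt.mpr this)
      have : (m i).2 ≤ c.2 := hmm i c hc (hl ▸ hx hli)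
      exact absurd (this.trans hcp.2) (not_le.mpr h4)

theorem volume_steps {x y : ℕ → ℝ} (hx : Monotone x) (hy : ∀ i, 0 ≤ y i) (N : ℕ) :
    MeasurableSet {p : ℝ × ℝ | ∃ i < N, x i ≤ p.1 ∧ p.1 < x (i + 1) ∧ 0 ≤ p.2 ∧ p.2 < y i} ∧
    volume {p : ℝ × ℝ | ∃ i < N, x i ≤ p.1 ∧ p.1 < x (i + 1) ∧ 0 ≤ p.2 ∧ p.2 < y i} =
      ENNReal.ofReal (∑ i ∈ Finset.range N, (x (i + 1) - x i) * y i) := by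
  have hset : {p : ℝ × ℝ | ∃ i < N, x i ≤ p.1 ∧ p.1 < x (i + 1) ∧ 0 ≤ p.2 ∧ p.2 < y i} =
      ⋃ i ∈ Finset.range N, Set.Ico (x i) (x (i + 1)) ×ˢ Set.Ico 0 (y i) := by
    ext p
    simp only [Set.mem_ofPred_eq, Set.mem_iUnion, Finset.mem_range, Set.mem_prod, Set.mem_Ico,
      exists_prop, and_assoc]
  have hmeas : ∀ i, MeasurableSet (Set.Ico (x i) (x (i + 1)) ×ˢ Set.Ico 0 (y i)) :=
    fun i => measurableSet_Ico.prod measurableSet_Ico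
  rw [hset]
  refine ⟨Finset.measurableSet_biUnion _ fun i _ => hmeas i, ?_⟩
  rw [measure_biUnion_finset _ fun i _ => hmeas i, ENNReal.ofReal_sum_of_nonneg]
  · refine Finset.sum_congr rfl fun i _ => ?_
    rw [Measure.volume_eq_prod, Measure.prod_prod, Real.volume_Ico, Real.volume_Ico, sub_zero,
      ENNReal.ofReal_mul (sub_nonneg.mpr (hx (Nat.le_succ i)))]
  · exact fun i _ => mul_nonneg (sub_nonneg.mpr (hx (Nat.le_succ i))) (hy i)
  · intro a _ b _ hab
    refine Set.disjoint_left.mpr fun p hp hq => ?_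
    rcases lt_or_gt_of_ne hab with h | h
    · have := hx (Nat.succ_le_of_lt h)
      exact absurd (hp.1.2.trans_le this) (not_lt.mpr hq.1.1)
    · have := hx (Nat.succ_le_of_lt h)
      exact absurd (hq.1.2.trans_le this) (not_lt.mpr hp.1.1)

/-- The staircase has area `j` times the covolume. -/
theorem sum_steps_eq {j : ℕ} {x y : ℕ → ℝ} (hx : Monotone x) (hy : ∀ i, 0 ≤ y i)
    (h : stair L j = {p | ∃ i < 2 * j, x i ≤ p.1 ∧ p.1 < x (i + 1) ∧ 0 ≤ p.2 ∧ p.2 < y i}) :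
    ∑ i ∈ Finset.range (2 * j), (x (i + 1) - x i) * y i = j * ZLattice.covolume L := by
  obtain ⟨hm, hv⟩ := volume_steps hx hy (2 * j)
  rw [← h] at hm hv
  have := measure_eq_of_encard_coset L volume hm j (encard_coset_stair L j)
  rw [hv, ← ENNReal.ofReal_natCast, ← ENNReal.ofReal_mul (by positivity)] at this
  refine (ENNReal.ofReal_eq_ofReal_iff ?_ ?_).mp this
  · exact Finset.sum_nonneg fun i _ => mul_nonneg (sub_nonneg.mpr (hx (Nat.le_succ i))) (hy i)
  · exact mul_nonneg (by positivity) (ZLattice.covolume_pos L volume).le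

/-- The corners of the staircase of a packing lattice lie beyond the hypotenuse. -/
theorem le_of_packing {j : ℕ} {s : ℝ}
    (h : ∀ z, {v | v ∈ L ∧ z - v ∈ openTriangle s}.encard ≤ j) {p : ℝ × ℝ} (hp : 0 ≤ p)
    (hr : j ≤ rank L p) : s ≤ p.1 + p.2 := by
  by_contra! hlt
  set ε := (s - (p.1 + p.2)) / 3 with hε
  have hε0 : 0 < ε := by rw [hε]; linarith
  -- A diagonal push off the boundary puts one point in the interiors of at least `j + 1`
  -- translates; positive `v` have nonnegative coordinate sum, so subtracting them does not cross
  -- the hypotenuse.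
  have hsub : insert 0 (below L p) ⊆ {v | v ∈ L ∧ p + (ε, ε) - v ∈ openTriangle s} := by
    rintro v (rfl | ⟨hv, hpos, hle⟩)
    · refine ⟨zero_mem _, ?_, ?_, ?_⟩
      · have : 0 ≤ p.1 := hp.1
        simp; linarith
      · have : 0 ≤ p.2 := hp.2
        simp; linarith
      · simp; linarith
    · have h1 : v.1 ≤ p.1 := hle.1
      have h2 : v.2 ≤ p.2 := hle.2
      have h3 := hpos.sum_nonneg
      refine ⟨hv, ?_, ?_, ?_⟩ <;> simp <;> linarith
  have h1 := (Set.encard_le_encard hsub).trans (h _)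
  rw [Set.encard_insert_of_notMem fun h0 => not_pos_zero h0.2.1,
    ← (below_finite L p).cast_ncard_eq] at h1
  have h2 : rank L p + 1 ≤ j := by exact_mod_cast h1
  omega

/-- The staircase of a covering lattice lies in the triangle. -/
theorem le_rank_of_covering {j : ℕ} {s : ℝ}
    (h : ∀ z, (j : ℕ∞) ≤ {v | v ∈ L ∧ z - v ∈ closedTriangle s}.encard) {p : ℝ × ℝ}
    (hs : s < p.1 + p.2) : j ≤ rank L p := by
  -- As `p` is strictly beyond the hypotenuse, a vector that brings it back into the triangle has
  -- positive coordinate sum.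
  have hsub : {v | v ∈ L ∧ p - v ∈ closedTriangle s} ⊆ below L p := by
    rintro v ⟨hv, h1, h2, h3⟩
    simp only [Prod.fst_sub, Prod.snd_sub] at h1 h2 h3
    refine ⟨hv, Or.inl (by linarith), ?_, ?_⟩ <;> linarith
  have h1 := (h p).trans (Set.encard_le_encard hsub)
  rw [← (below_finite L p).cast_ncard_eq] at h1
  exact_mod_cast h1

/-- The extremal problem for staircases containing a triangle. -/
theorem packing_sum {N : ℕ} {x y : ℕ → ℝ} (hx : Monotone x) (hx0 : x 0 = 0)
    (hy : ∀ i, 0 ≤ y i) (hyN : y N = 0) (h : ∀ i, (N : ℝ) ≤ x i + y i) :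
    (N : ℝ) * (N + 1) ≤ 2 * ∑ i ∈ Finset.range N, (x (i + 1) - x i) * y i ∧
    ((N : ℝ) * (N + 1) = 2 * ∑ i ∈ Finset.range N, (x (i + 1) - x i) * y i →
      (∀ i ≤ N, x i = i) ∧ ∀ i < N, y i = N - i) := by
  -- Cutting off what lies to the right of the triangle makes the abscissas run exactly from `0` to
  -- `N`, as the telescoping sum needs.
  set u : ℕ → ℝ := fun i => min (x i) N with hu
  have hu0 : u 0 = 0 := by simp [hu, hx0]
  have huN : u N = N := by
    have := h N
    rw [hyN, add_zero] at this
    exact min_eq_right this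
  have hmono : ∀ i, u i ≤ u (i + 1) := fun i => min_le_min (hx (Nat.le_succ i)) le_rfl
  have hd : ∀ i, u (i + 1) - u i ≤ x (i + 1) - x i := by
    intro i
    have := hx (Nat.le_succ i)
    simp only [hu]
    rcases le_total (x i) N with h1 | h1
    · rw [min_eq_left h1]
      have := min_le_left (x (i + 1)) N
      linarith
    · rw [min_eq_right h1, min_eq_right (h1.trans this)]
      simp only [Nat.succ_eq_add_one] at this
      linarith
  have hterm1 : ∀ i, (u (i + 1) - u i) * y i ≤ (x (i + 1) - x i) * y i := fun i =>
    mul_le_mul_of_nonneg_right (hd i) (hy i)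
  have hterm2 : ∀ i, (u (i + 1) - u i) * (N - u i) ≤ (u (i + 1) - u i) * y i := by
    intro i
    rcases le_total (x i) N with h1 | h1
    · refine mul_le_mul_of_nonneg_left ?_ (sub_nonneg.mpr (hmono i))
      simp only [hu, min_eq_left h1]
      linarith [h i]
    · have h2 : u i = N := min_eq_right h1
      have h3 : u (i + 1) = N := min_eq_right (h1.trans (hx (Nat.le_succ i)))
      rw [h2, h3]; simp
  -- The excess is a sum of squares, so equality forces unit steps.
  have hsum : 2 * ∑ i ∈ Finset.range N, (u (i + 1) - u i) * (N - u i) =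
      (N : ℝ) * (N + 1) + ∑ i ∈ Finset.range N, (u (i + 1) - u i - 1) ^ 2 := by
    have h1 : ∀ i ∈ Finset.range N, 2 * ((u (i + 1) - u i) * (N - u i)) =
        ((2 * N + 2) * u (i + 1) - u (i + 1) ^ 2 - ((2 * N + 2) * u i - u i ^ 2)) +
          (u (i + 1) - u i - 1) ^ 2 - 1 := fun i _ => by ring
    rw [Finset.mul_sum, Finset.sum_congr rfl h1, Finset.sum_sub_distrib, Finset.sum_add_distrib,
      Finset.sum_range_sub (fun i => (2 * N + 2) * u i - u i ^ 2), hu0, huN]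
    simp
    ring
  have hle1 := Finset.sum_le_sum fun i (_ : i ∈ Finset.range N) => hterm1 i
  have hle2 := Finset.sum_le_sum fun i (_ : i ∈ Finset.range N) => hterm2 i
  have hsq : 0 ≤ ∑ i ∈ Finset.range N, (u (i + 1) - u i - 1) ^ 2 :=
    Finset.sum_nonneg fun _ _ => sq_nonneg _
  refine ⟨by linarith, fun heq => ?_⟩
  have hsq0 : ∑ i ∈ Finset.range N, (u (i + 1) - u i - 1) ^ 2 = 0 := by linarith
  rw [Finset.sum_eq_zero_iff_of_nonneg fun _ _ => sq_nonneg _] at hsq0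
  have hu1 : ∀ i ≤ N, u i = i := by
    intro i hi
    induction i with
    | zero => simpa using hu0
    | succ k ih =>
      have := hsq0 k (Finset.mem_range.mpr (by omega))
      have := pow_eq_zero_iff (two_ne_zero) |>.mp this
      rw [ih (by omega)] at this
      push_cast; linarith
  have he1 := (Finset.sum_eq_sum_iff_of_le fun i (_ : i ∈ Finset.range N) => hterm1 i).mp
    (by linarith)
  have he2 := (Finset.sum_eq_sum_iff_of_le fun i (_ : i ∈ Finset.range N) => hterm2 i).mp
    (by linarith)
  have hyi : ∀ i < N, y i = N - i := by
    intro i hi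
    have := he2 i (Finset.mem_range.mpr hi)
    rw [hu1 i hi.le, hu1 (i + 1) hi] at this
    push_cast at this
    linarith
  refine ⟨fun i hi => ?_, hyi⟩
  induction i with
  | zero => simpa using hx0
  | succ k ih =>
    have hk : k < N := by omega
    have := he1 k (Finset.mem_range.mpr hk)
    rw [hu1 k hk.le, hu1 (k + 1) hi, hyi k hk, ih hk.le] at this
    have hne : (N : ℝ) - k ≠ 0 := sub_ne_zero.mpr (by exact_mod_cast hk.ne')
    have := mul_right_cancel₀ hne this
    push_cast at this ⊢
    linarith

/-- The extremal problem for staircases contained in a triangle. -/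
theorem covering_sum {N : ℕ} {x y : ℕ → ℝ} (hx0 : x 0 = 0)
    (h : ∀ i < N, (x (i + 1) - x i) * y i ≤ (x (i + 1) - x i) * (N + 1 - x (i + 1))) :
    2 * ∑ i ∈ Finset.range N, (x (i + 1) - x i) * y i ≤ (N : ℝ) * (N + 1) ∧
    ((N : ℝ) * (N + 1) = 2 * ∑ i ∈ Finset.range N, (x (i + 1) - x i) * y i →
      (∀ i ≤ N, x i = i) ∧ ∀ i < N, y i = N - i) := by
  -- Here `x N` need not be `N` beforehand; the last square accounts for the difference.
  have hsum : 2 * ∑ i ∈ Finset.range N, (x (i + 1) - x i) * (N + 1 - x (i + 1)) =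
      (N : ℝ) * (N + 1) - (∑ i ∈ Finset.range N, (x (i + 1) - x i - 1) ^ 2 + (N - x N) ^ 2) := by
    have h1 : ∀ i ∈ Finset.range N, 2 * ((x (i + 1) - x i) * (N + 1 - x (i + 1))) =
        (2 * N * x (i + 1) - x (i + 1) ^ 2 - (2 * N * x i - x i ^ 2)) -
          (x (i + 1) - x i - 1) ^ 2 + 1 := fun i _ => by ring
    rw [Finset.mul_sum, Finset.sum_congr rfl h1, Finset.sum_add_distrib, Finset.sum_sub_distrib,
      Finset.sum_range_sub (fun i => 2 * N * x i - x i ^ 2), hx0]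
    simp
    ring
  have hle := Finset.sum_le_sum fun i (hi : i ∈ Finset.range N) => h i (Finset.mem_range.mp hi)
  have hsq : 0 ≤ ∑ i ∈ Finset.range N, (x (i + 1) - x i - 1) ^ 2 :=
    Finset.sum_nonneg fun _ _ => sq_nonneg _
  have hsq' := sq_nonneg (N - x N)
  refine ⟨by linarith, fun heq => ?_⟩
  have hsq0 : ∑ i ∈ Finset.range N, (x (i + 1) - x i - 1) ^ 2 = 0 := by linarith
  rw [Finset.sum_eq_zero_iff_of_nonneg fun _ _ => sq_nonneg _] at hsq0
  have hxi : ∀ i ≤ N, x i = i := by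
    intro i hi
    induction i with
    | zero => simpa using hx0
    | succ k ih =>
      have := hsq0 k (Finset.mem_range.mpr (by omega))
      have := pow_eq_zero_iff (two_ne_zero) |>.mp this
      rw [ih (by omega)] at this
      push_cast; linarith
  have he := (Finset.sum_eq_sum_iff_of_le fun i (hi : i ∈ Finset.range N) =>
    h i (Finset.mem_range.mp hi)).mp (by linarith)
  refine ⟨hxi, fun i hi => ?_⟩
  have := he i (Finset.mem_range.mpr hi)
  rw [hxi i hi.le, hxi (i + 1) hi] at this
  push_cast at this
  linarith

theorem steps_eq_unitStair {j : ℕ} {x y : ℕ → ℝ} (hx : ∀ i ≤ 2 * j, x i = i)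
    (hy : ∀ i < 2 * j, y i = (2 * j : ℕ) - i) :
    {p : ℝ × ℝ | ∃ i < 2 * j, x i ≤ p.1 ∧ p.1 < x (i + 1) ∧ 0 ≤ p.2 ∧ p.2 < y i} =
      unitStair j := by
  ext p
  refine exists_congr fun i => and_congr_right fun hi => ?_
  rw [hx i hi.le, hx (i + 1) hi, hy i hi]
  push_cast
  rfl

/-- The density bound for `j`-fold lattice packings with a triangle. -/
theorem packing_bound {j : ℕ} (hj : 1 ≤ j)
    (h : ∀ z, {v | v ∈ L ∧ z - v ∈ openTriangle (2 * j)}.encard ≤ j) :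
    2 * (j : ℝ) + 1 ≤ ZLattice.covolume L ∧
      (ZLattice.covolume L = 2 * (j : ℝ) + 1 → stair L j = unitStair j) := by
  obtain ⟨x, y, hx, hx0, hy, -, hyN, hst⟩ := exists_steps L hj
  have hxn : ∀ i, 0 ≤ x i := fun i => hx0 ▸ hx (Nat.zero_le i)
  have hA := sum_steps_eq L hx (fun i => (hy i).1) hst
  obtain ⟨h1, h2⟩ := packing_sum (N := 2 * j) hx hx0 (fun i => (hy i).1) hyN
    (fun i => by
      have := le_of_packing L h (p := (x i, y i)) ⟨hxn i, (hy i).1⟩ (hy i).2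
      push_cast; exact this)
  rw [hA] at h1 h2
  push_cast at h1 h2
  have hj0 : (0 : ℝ) < j := by exact_mod_cast hj
  refine ⟨?_, fun heq => ?_⟩
  · refine le_of_mul_le_mul_left ?_ (mul_pos two_pos hj0)
    linarith
  · obtain ⟨h3, h4⟩ := h2 (by rw [heq]; ring)
    rw [hst]
    exact steps_eq_unitStair h3 (fun i hi => by rw [h4 i hi]; push_cast; rfl)

/-- The density bound for `j`-fold lattice coverings with a triangle. -/
theorem covering_bound {j : ℕ} (hj : 1 ≤ j)
    (h : ∀ z, (j : ℕ∞) ≤ {v | v ∈ L ∧ z - v ∈ closedTriangle (2 * j + 1)}.encard) :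
    ZLattice.covolume L ≤ 2 * (j : ℝ) + 1 ∧
      (ZLattice.covolume L = 2 * (j : ℝ) + 1 → stair L j = unitStair j) := by
  obtain ⟨x, y, hx, hx0, hy, hypos, -, hst⟩ := exists_steps L hj
  have hA := sum_steps_eq L hx (fun i => (hy i).1) hst
  obtain ⟨h1, h2⟩ := covering_sum (N := 2 * j) hx0 (y := y) (fun i hi => by
      rcases (hx (Nat.le_succ i)).eq_or_lt with he | hlt
      · simp only [Nat.succ_eq_add_one] at he
        rw [he]; simp
      · simp only [Nat.succ_eq_add_one] at hlt
        have hyi := hypos i hlt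
        refine mul_le_mul_of_nonneg_left ?_ (sub_nonneg.mpr hlt.le)
        by_contra! hcon
        push_cast at hcon
        -- The first two bounds keep the point just inside the outer corner of the step in the
        -- staircase; the third keeps it beyond the hypotenuse.
        obtain ⟨ε, hε0, hε⟩ := exists_between (lt_min (sub_pos.mpr hlt) (lt_min hyi
          (show 0 < (y i + x (i + 1) - (2 * j + 1)) / 2 by linarith)))
        rw [lt_min_iff, lt_min_iff] at hε
        have hmem : (x (i + 1) - ε, y i - ε) ∈ stair L j := by
          rw [hst]
          refine ⟨i, hi, ?_, ?_, ?_, ?_⟩ <;> simp only <;> linarith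
        refine absurd (le_rank_of_covering L h (p := (x (i + 1) - ε, y i - ε)) ?_)
          (not_le.mpr hmem.2)
        simp only
        linarith)
  rw [hA] at h1 h2
  push_cast at h1 h2
  have hj0 : (0 : ℝ) < j := by exact_mod_cast hj
  refine ⟨?_, fun heq => ?_⟩
  · refine le_of_mul_le_mul_left ?_ (mul_pos two_pos hj0)
    linarith
  · obtain ⟨h3, h4⟩ := h2 (by rw [heq]; ring)
    rw [hst]
    exact steps_eq_unitStair h3 (fun i hi => by rw [h4 i hi]; push_cast; rfl)

end

/-! ### Lattices whose staircase is the unit staircase. -/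

/-- The lattice of the integer points `(a, b)` with `b ≡ c a` modulo `n`. -/
def congruenceLattice (n : ℕ) (c : ZMod n) : Submodule ℤ (ℝ × ℝ) where
  carrier := {p | ∃ a b : ℤ, p = ((a : ℝ), (b : ℝ)) ∧ (b : ZMod n) = c * a}
  add_mem' := by
    rintro _ _ ⟨a, b, rfl, h⟩ ⟨a', b', rfl, h'⟩
    exact ⟨a + a', b + b', by simp, by push_cast; rw [h, h']; ring⟩
  zero_mem' := ⟨0, 0, by simp; rfl, by simp⟩
  smul_mem' := by
    rintro k _ ⟨a, b, rfl, h⟩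
    exact ⟨k * a, k * b, by simp, by push_cast; rw [h]; ring⟩

theorem mem_congruenceLattice {n : ℕ} {c : ZMod n} {p : ℝ × ℝ} :
    p ∈ congruenceLattice n c ↔
      ∃ a b : ℤ, p = ((a : ℝ), (b : ℝ)) ∧ (b : ZMod n) = c * a := Iff.rfl

theorem mem_unitStair_iff {j : ℕ} {p : ℝ × ℝ} :
    p ∈ unitStair j ↔ 0 ≤ p.1 ∧ 0 ≤ p.2 ∧ p.2 < 2 * j - (⌊p.1⌋ : ℝ) := by
  constructor
  · rintro ⟨i, hi, h1, h2, h3, h4⟩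
    have : ⌊p.1⌋ = (i : ℤ) := Int.floor_eq_iff.mpr ⟨by exact_mod_cast h1, by exact_mod_cast h2⟩
    refine ⟨(Nat.cast_nonneg i).trans h1, h3, ?_⟩
    rw [this]; exact_mod_cast h4
  · rintro ⟨h1, h2, h3⟩
    have h0 : 0 ≤ ⌊p.1⌋ := Int.floor_nonneg.mpr h1
    obtain ⟨i, hi⟩ := Int.eq_ofNat_of_zero_le h0
    rw [hi] at h3
    have h5 := Int.floor_le p.1
    have h6 := Int.lt_floor_add_one p.1
    rw [hi] at h5 h6
    push_cast at h3 h5 h6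
    refine ⟨i, ?_, h5, h6, h2, h3⟩
    have : (i : ℝ) < 2 * j := by linarith
    exact_mod_cast this

section

variable {L : Submodule ℤ (ℝ × ℝ)}

theorem encard_translate_of_encard_coset {D : Set (ℝ × ℝ)} {j : ℕ}
    (h : ∀ z : ℝ × ℝ, {q | q ∈ D ∧ q - z ∈ L}.encard = j) (z : ℝ × ℝ) :
    {v | v ∈ L ∧ v - z ∈ D}.encard = j := by
  have hinj : Function.Injective (fun v : ℝ × ℝ => v - z) := sub_left_injective
  rw [← h (-z), ← hinj.encard_image]
  congr 1
  ext q
  constructor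
  · rintro ⟨v, ⟨hv, hq⟩, rfl⟩
    exact ⟨hq, by simpa using hv⟩
  · rintro ⟨hq, hqz⟩
    exact ⟨q + z, ⟨by simpa using hqz, by simpa using hq⟩, by simp⟩

/-- The lattice vectors on the left edge of a translate of the unit staircase. -/
def leftEdge (L : Submodule ℤ (ℝ × ℝ)) (j : ℕ) (z : ℝ) : Set (ℝ × ℝ) :=
  {v | v ∈ L ∧ v.1 = 0 ∧ z - 2 * j ≤ v.2 ∧ v.2 < z}

/-- The lattice vectors on the right edges of a translate of the unit staircase. -/
def rightEdges (L : Submodule ℤ (ℝ × ℝ)) (j : ℕ) (z : ℝ) : Set (ℝ × ℝ) :=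
  {v | v ∈ L ∧ (∃ i : ℕ, 1 ≤ i ∧ i ≤ 2 * j ∧ v.1 = i) ∧ z ≤ v.1 + v.2 ∧ v.1 + v.2 < z + 1}

/-- The edges of the unit staircase match, since it tiles. -/
theorem ncard_leftEdge_eq [DiscreteTopology L] [IsZLattice ℝ L] {j : ℕ}
    (h : ∀ z : ℝ × ℝ, {v | v ∈ L ∧ v - z ∈ unitStair j}.encard = j) (z : ℝ) :
    (leftEdge L j z).ncard = (rightEdges L j z).ncard := by
  classical
  set y := z - 2 * j with hy
  have hKfin := finite_inter_lattice L (Metric.isBounded_Icc ((0, y) : ℝ × ℝ) (2 * j + 2, y + 2 * j))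
  set K := Set.Icc ((0, y) : ℝ × ℝ) (2 * j + 2, y + 2 * j) ∩ (L : Set (ℝ × ℝ))
  -- Slide the staircase right by `ε`, at most every positive fractional part of an abscissa in
  -- play. Only vectors on the left edge are lost and only vectors on the right edges are gained,
  -- while the total stays `j`.
  obtain ⟨ε, hε0, hε1, hε⟩ : ∃ ε : ℝ, 0 < ε ∧ ε < 1 ∧
      ∀ v ∈ K, 0 < Int.fract v.1 → ε ≤ Int.fract v.1 := by
    obtain ⟨c, hc, hmin⟩ := Set.exists_min_image
      (insert (1 / 2 : ℝ) ((fun v : ℝ × ℝ => Int.fract v.1) '' {v | v ∈ K ∧ 0 < Int.fract v.1})) id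
      (((hKfin.subset fun _ h => h.1).image _).insert _) (Set.insert_nonempty _ _)
    refine ⟨c, ?_, ?_, fun v hv h0 => hmin _ (Set.mem_insert_of_mem _ ⟨v, ⟨hv, h0⟩, rfl⟩)⟩
    · rcases hc with rfl | ⟨v, hv, rfl⟩
      · norm_num
      · exact hv.2
    · exact (hmin _ (Set.mem_insert _ _)).trans_lt (by norm_num)
  set S := {v | v ∈ L ∧ v - (0, y) ∈ unitStair j} with hS
  set S' := {v | v ∈ L ∧ v - (ε, y) ∈ unitStair j} with hS'
  have hSfin : S.Finite := Set.finite_of_encard_eq_coe (h _)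
  have hSfin' : S'.Finite := Set.finite_of_encard_eq_coe (h _)
  have hcard : S.ncard = S'.ncard := by
    rw [Set.ncard_def, Set.ncard_def, hS, hS', h, h]
  have hj0 : (0 : ℝ) ≤ 2 * j := by positivity
  have hmemS : ∀ v, v ∈ S ↔ v ∈ L ∧ 0 ≤ v.1 ∧ y ≤ v.2 ∧ v.2 < z - ⌊v.1⌋ := by
    intro v
    simp only [hS, Set.mem_ofPred_eq, mem_unitStair_iff, Prod.fst_sub, Prod.snd_sub, sub_zero,
      sub_nonneg]
    refine and_congr_right fun _ => and_congr_right fun _ => and_congr_right fun _ => ?_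
    constructor <;> intro h <;> linarith
  have hmemS' : ∀ v, v ∈ S' ↔ v ∈ L ∧ ε ≤ v.1 ∧ y ≤ v.2 ∧ v.2 < z - ⌊v.1 - ε⌋ := by
    intro v
    simp only [hS', Set.mem_ofPred_eq, mem_unitStair_iff, Prod.fst_sub, Prod.snd_sub,
      sub_nonneg]
    refine and_congr_right fun _ => and_congr_right fun _ => and_congr_right fun _ => ?_
    constructor <;> intro h <;> linarith
  have hfloor : ∀ v ∈ K, (Int.fract v.1 = 0 ∧ ⌊v.1 - ε⌋ = ⌊v.1⌋ - 1) ∨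
      (ε ≤ Int.fract v.1 ∧ ⌊v.1 - ε⌋ = ⌊v.1⌋) := by
    intro v hv
    have h3 := Int.fract_lt_one v.1
    have h4 := Int.floor_add_fract v.1
    rcases (Int.fract_nonneg v.1).eq_or_lt with h0 | h0
    · left
      refine ⟨h0.symm, Int.floor_eq_iff.mpr ⟨?_, ?_⟩⟩ <;> push_cast <;> linarith
    · right
      have h2 := hε v hv h0
      refine ⟨h2, Int.floor_eq_iff.mpr ⟨?_, ?_⟩⟩ <;> linarith
  have hSK : S ⊆ K := by
    intro v hv
    obtain ⟨hv, h1, h2, h3⟩ := (hmemS v).mp hv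
    have h4 : (0 : ℝ) ≤ ⌊v.1⌋ := by exact_mod_cast Int.floor_nonneg.mpr h1
    have h5 := Int.lt_floor_add_one v.1
    refine ⟨⟨⟨h1, h2⟩, ⟨?_, ?_⟩⟩, hv⟩ <;> simp only <;> linarith
  have hSK' : S' ⊆ K := by
    intro v hv
    obtain ⟨hv, h1, h2, h3⟩ := (hmemS' v).mp hv
    have h4 : (0 : ℝ) ≤ ⌊v.1 - ε⌋ := by exact_mod_cast Int.floor_nonneg.mpr (sub_nonneg.mpr h1)
    have h5 := Int.lt_floor_add_one (v.1 - ε)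
    refine ⟨⟨⟨hε0.le.trans h1, h2⟩, ⟨?_, ?_⟩⟩, hv⟩ <;> simp only <;> linarith
  have hleft : leftEdge L j z = S \ S' := by
    ext v
    constructor
    · rintro ⟨hv, h1, h2, h3⟩
      refine ⟨(hmemS v).mpr ⟨hv, h1.ge, h2, by rw [h1]; simpa using h3⟩, fun h' => ?_⟩
      have := ((hmemS' v).mp h').2.1
      linarith
    · rintro ⟨hv, hv'⟩
      obtain ⟨hL, h1, h2, h3⟩ := (hmemS v).mp hv
      have h4 : (0 : ℝ) ≤ ⌊v.1⌋ := by exact_mod_cast Int.floor_nonneg.mpr h1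
      have h5 := Int.floor_add_fract v.1
      rcases hfloor v (hSK hv) with ⟨h0, hf⟩ | ⟨h0, hf⟩
      · refine ⟨hL, ?_, h2, by linarith⟩
        by_contra hne
        have hpos : 0 < v.1 := lt_of_le_of_ne h1 (Ne.symm hne)
        have h6 : 1 ≤ ⌊v.1⌋ := by
          have : (0 : ℝ) < ⌊v.1⌋ := by linarith
          exact_mod_cast this
        have h6 : (1 : ℝ) ≤ ⌊v.1⌋ := by exact_mod_cast h6
        refine hv' ((hmemS' v).mpr ⟨hL, by linarith, h2, ?_⟩)
        rw [hf]; push_cast; linarith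
      · refine absurd ((hmemS' v).mpr ⟨hL, by linarith, h2, ?_⟩) hv'
        rw [hf]; exact h3
  have hright : rightEdges L j z = S' \ S := by
    ext v
    constructor
    · rintro ⟨hL, ⟨i, hi1, hi2, hi⟩, h2, h3⟩
      have hi1' : (1 : ℝ) ≤ i := by exact_mod_cast hi1
      have hi2' : (i : ℝ) ≤ 2 * j := by exact_mod_cast hi2
      have hfl : ⌊v.1⌋ = (i : ℤ) := by rw [hi]; simp
      have hfl' : ⌊v.1 - ε⌋ = (i : ℤ) - 1 := by
        refine Int.floor_eq_iff.mpr ⟨?_, ?_⟩ <;> push_cast <;> linarith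
      refine ⟨(hmemS' v).mpr ⟨hL, by linarith, by linarith, ?_⟩, fun h' => ?_⟩
      · rw [hfl']; push_cast; linarith
      · have := ((hmemS v).mp h').2.2.2
        rw [hfl] at this
        push_cast at this
        linarith
    · rintro ⟨hv, hv'⟩
      obtain ⟨hL, h1, h2, h3⟩ := (hmemS' v).mp hv
      have h4 : (0 : ℝ) ≤ ⌊v.1⌋ := by exact_mod_cast Int.floor_nonneg.mpr (hε0.le.trans h1)
      have h5 := Int.floor_add_fract v.1
      rcases hfloor v (hSK' hv) with ⟨h0, hf⟩ | ⟨h0, hf⟩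
      · have h6 : v.1 = ⌊v.1⌋ := by linarith
        obtain ⟨i, hi⟩ := Int.eq_ofNat_of_zero_le (Int.floor_nonneg.mpr (hε0.le.trans h1))
        have hvi : v.1 = i := by
          rw [hi] at h6; exact_mod_cast h6
        have hi1 : 1 ≤ i := by
          have : (0 : ℝ) < i := by linarith
          exact_mod_cast this
        rw [hf, hi] at h3
        push_cast at h3
        have hi2 : i ≤ 2 * j := by
          have : (i : ℝ) < 2 * j + 1 := by linarith
          have : i < 2 * j + 1 := by exact_mod_cast this
          omega
        refine ⟨hL, ⟨i, hi1, hi2, hvi⟩, ?_, by linarith⟩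
        by_contra! hcon
        refine hv' ((hmemS v).mpr ⟨hL, by linarith, h2, ?_⟩)
        rw [hi]; push_cast; linarith
      · refine absurd ((hmemS v).mpr ⟨hL, by linarith, h2, ?_⟩) hv'
        rw [← hf]; exact h3
  rw [hleft, hright]
  have h1 := Set.ncard_inter_add_ncard_sdiff_eq_ncard S S' hSfin
  have h2 := Set.ncard_inter_add_ncard_sdiff_eq_ncard S' S hSfin'
  rw [Set.inter_comm] at h2
  omega

/-- The point `(1, 2 j - 1)` is just outside the half-open staircase. Without a lattice vector of
abscissa `1` it could move left, into the first column, without losing any vector below it. -/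
theorem exists_fst_eq_one [DiscreteTopology L] [IsZLattice ℝ L] {j : ℕ} (hj : 1 ≤ j)
    (h : stair L j = unitStair j) : ∃ v ∈ L, v.1 = 1 := by
  have hj1 : (1 : ℝ) ≤ j := by exact_mod_cast hj
  have h1 : j ≤ rank L (1, 2 * j - 1) := by
    by_contra! hcon
    have : ((1, 2 * j - 1) : ℝ × ℝ) ∈ stair L j :=
      ⟨⟨zero_le_one, by simp only [Prod.snd_zero]; linarith⟩, hcon⟩
    rw [h, mem_unitStair_iff] at this
    simp at this
  by_contra! hcon
  obtain ⟨c, hc, hmax⟩ := Set.exists_max_image (insert 0 (below L (1, 2 * j - 1)))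
    Prod.fst ((below_finite L _).insert 0) (Set.insert_nonempty _ _)
  have h0 : 0 ≤ c.1 := hmax 0 (Set.mem_insert _ _)
  have hlt : c.1 < 1 := by
    rcases hc with rfl | hc
    · exact one_pos
    · exact lt_of_le_of_ne hc.2.2.1 (hcon c hc.1)
  have h2 : j ≤ rank L (c.1, 2 * j - 1) := h1.trans (Set.ncard_le_ncard (fun v hv =>
    ⟨hv.1, hv.2.1, hmax v (Set.mem_insert_of_mem _ hv), hv.2.2.2⟩) (below_finite L _))
  have h3 : ((c.1, 2 * j - 1) : ℝ × ℝ) ∈ unitStair j := by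
    rw [mem_unitStair_iff]
    have : ⌊c.1⌋ = 0 := Int.floor_eq_iff.mpr ⟨by simpa using h0, by simpa using hlt⟩
    refine ⟨h0, by simp only; linarith, ?_⟩
    simp only [this]; push_cast; linarith
  rw [← h] at h3
  exact absurd h3.2 (not_lt.mpr h2)

theorem exists_snd_eq_one [DiscreteTopology L] [IsZLattice ℝ L] {j : ℕ} (hj : 1 ≤ j)
    (h : stair L j = unitStair j) : ∃ v ∈ L, v.2 = 1 := by
  have hj1 : (1 : ℝ) ≤ j := by exact_mod_cast hj
  have hfl : ⌊2 * (j : ℝ) - 1⌋ = 2 * (j : ℤ) - 1 := by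
    have : 2 * (j : ℝ) - 1 = ((2 * (j : ℤ) - 1 : ℤ) : ℝ) := by push_cast; ring
    rw [this, Int.floor_intCast]
  have h1 : j ≤ rank L (2 * j - 1, 1) := by
    by_contra! hcon
    have : ((2 * j - 1, 1) : ℝ × ℝ) ∈ stair L j :=
      ⟨⟨by simp only [Prod.fst_zero]; linarith, zero_le_one⟩, hcon⟩
    rw [h, mem_unitStair_iff] at this
    simp only [hfl] at this
    push_cast at this
    linarith [this.2.2]
  by_contra! hcon
  obtain ⟨c, hc, hmax⟩ := Set.exists_max_image (insert 0 (below L (2 * j - 1, 1)))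
    Prod.snd ((below_finite L _).insert 0) (Set.insert_nonempty _ _)
  have h0 : 0 ≤ c.2 := hmax 0 (Set.mem_insert _ _)
  have hlt : c.2 < 1 := by
    rcases hc with rfl | hc
    · exact one_pos
    · exact lt_of_le_of_ne hc.2.2.2 (hcon c hc.1)
  have h2 : j ≤ rank L (2 * j - 1, c.2) := h1.trans (Set.ncard_le_ncard (fun v hv =>
    ⟨hv.1, hv.2.1, hv.2.2.1, hmax v (Set.mem_insert_of_mem _ hv)⟩) (below_finite L _))
  have h3 : ((2 * j - 1, c.2) : ℝ × ℝ) ∈ unitStair j := by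
    rw [mem_unitStair_iff]
    refine ⟨by simp only; linarith, h0, ?_⟩
    simp only [hfl]; push_cast; linarith
  rw [← h] at h3
  exact absurd h3.2 (not_lt.mpr h2)

end

/-- Otherwise the bottom row of the staircase alone would hold `2 j` lattice points. -/
theorem one_zero_notMem {L : Submodule ℤ (ℝ × ℝ)} {j : ℕ} (hj : 1 ≤ j)
    (h : ∀ z : ℝ × ℝ, {v | v ∈ L ∧ v - z ∈ unitStair j}.encard = j) : ((1, 0) : ℝ × ℝ) ∉ L := by
  intro h1
  have hinj : Function.Injective (fun k : ℕ => ((k : ℝ), (0 : ℝ))) := by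
    intro a b hab
    simpa using hab
  have hsub : (fun k : ℕ => ((k : ℝ), (0 : ℝ))) '' (Finset.range (2 * j) : Set ℕ) ⊆
      {v | v ∈ L ∧ v - 0 ∈ unitStair j} := by
    rintro _ ⟨k, hk, rfl⟩
    have hk : k < 2 * j := by simpa using hk
    refine ⟨?_, k, hk, ?_⟩
    · have := L.smul_of_tower_mem k h1
      simpa using this
    · have : (k : ℝ) < 2 * j := by exact_mod_cast hk
      simp; linarith
  have := Set.encard_le_encard hsub
  rw [h, hinj.encard_image, Set.encard_coe_eq_coe_finsetCard, Finset.card_range] at this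
  have : 2 * j ≤ j := by exact_mod_cast this
  omega

section

variable {L : Submodule ℤ (ℝ × ℝ)} [DiscreteTopology L] [IsZLattice ℝ L]

theorem rightEdges_finite (j : ℕ) (z : ℝ) : (rightEdges L j z).Finite := by
  refine (finite_inter_lattice L
    (Metric.isBounded_Icc ((0, z - 2 * j) : ℝ × ℝ) (2 * j, z + 1))).subset ?_
  rintro v ⟨hv, ⟨i, -, hi, hvi⟩, h1, h2⟩
  have hi0 : (0 : ℝ) ≤ i := by positivity
  have hi' : (i : ℝ) ≤ 2 * j := by exact_mod_cast hi
  refine ⟨⟨⟨?_, ?_⟩, ?_, ?_⟩, hv⟩ <;> simp only <;> linarith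

/-- A lattice with a nonzero vertical vector has a shortest one, which generates the others. -/
theorem exists_vertical_generator {t : ℝ} (ht : t ≠ 0) (h : ((0, t) : ℝ × ℝ) ∈ L) :
    ∃ m : ℝ, 0 < m ∧ ((0, m) : ℝ × ℝ) ∈ L ∧
      ∀ s : ℝ, ((0, s) : ℝ × ℝ) ∈ L → ∃ k : ℤ, s = k * m := by
  have habs : ((0, |t|) : ℝ × ℝ) ∈ L := by
    rcases abs_choice t with h' | h' <;> rw [h']
    · exact h
    · simpa using neg_mem h
  have hfin : ({v : ℝ × ℝ | v ∈ Set.Icc ((0, 0) : ℝ × ℝ) (0, |t|) ∩ (L : Set (ℝ × ℝ)) ∧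
      0 < v.2}).Finite :=
    (finite_inter_lattice L (Metric.isBounded_Icc ((0, 0) : ℝ × ℝ) (0, |t|))).subset
      fun _ h => h.1
  obtain ⟨m, ⟨⟨hmI, hmL⟩, hm0⟩, hmin⟩ := Set.exists_min_image _ Prod.snd hfin
    ⟨(0, |t|), ⟨⟨⟨le_rfl, abs_nonneg t⟩, le_rfl⟩, habs⟩, abs_pos.mpr ht⟩
  have hm1 : m.1 = 0 := le_antisymm hmI.2.1 hmI.1.1
  have hme : m = (0, m.2) := Prod.ext hm1 rfl
  rw [hme] at hmL
  refine ⟨m.2, hm0, hmL, fun s hs => ⟨⌊s / m.2⌋, ?_⟩⟩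
  have hr : ((0, s - ⌊s / m.2⌋ * m.2) : ℝ × ℝ) ∈ L := by
    have := sub_mem hs (L.smul_mem ⌊s / m.2⌋ hmL)
    simpa using this
  have h1 : 0 ≤ s - ⌊s / m.2⌋ * m.2 := Int.sub_floor_div_mul_nonneg s hm0
  have h2 : s - ⌊s / m.2⌋ * m.2 < m.2 := Int.sub_floor_div_mul_lt s hm0
  by_contra hne
  have h3 : 0 < s - ⌊s / m.2⌋ * m.2 := lt_of_le_of_ne h1 fun h => hne (by linarith)
  have := hmin (0, s - ⌊s / m.2⌋ * m.2)
    ⟨⟨⟨⟨le_rfl, h1⟩, le_rfl, ?_⟩, hr⟩, h3⟩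
  · simp only at this; linarith
  · have := hmI.2.2
    simp only at this ⊢; linarith

/-- If `(1, b)` and `(0, m)` lie in the lattice, then `m` is a positive integer multiple of the
covolume, and they generate the lattice when the multiple is `1`. -/
theorem exists_index {b m : ℝ} (hm : 0 < m) (hb : ((1, b) : ℝ × ℝ) ∈ L)
    (h : ((0, m) : ℝ × ℝ) ∈ L) :
    ∃ q : ℕ, 1 ≤ q ∧ m = q * ZLattice.covolume L ∧
      (q = 1 → ∀ u ∈ L, ∃ k l : ℤ, u = ((k : ℝ), k * b + l * m)) := by
  obtain ⟨v, -, w, -, hgen, hdet⟩ := exists_basis_det L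
  obtain ⟨α, β, h1⟩ := hgen _ hb
  obtain ⟨γ, δ, h2⟩ := hgen _ h
  have e1 := congrArg Prod.fst h1
  have e2 := congrArg Prod.snd h1
  have e3 := congrArg Prod.fst h2
  have e4 := congrArg Prod.snd h2
  simp only [Prod.fst_add, Prod.snd_add, Prod.smul_fst, Prod.smul_snd] at e1 e2 e3 e4
  simp only [zsmul_eq_mul] at e1 e2 e3 e4
  -- `m` is the determinant of `(1, b)` and `(0, m)`, hence that of a basis times an integer
  -- determinant.
  have hmd : m = (α * δ - β * γ : ℤ) * (v.1 * w.2 - v.2 * w.1) := by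
    push_cast
    linear_combination m * e1 + (α * v.1 + β * w.1) * e4 - b * e3 - (γ * v.1 + δ * w.1) * e2
  have hq : m = (α * δ - β * γ).natAbs * ZLattice.covolume L := by
    rw [← hdet, Nat.cast_natAbs, Int.cast_abs, ← abs_mul, ← hmd, abs_of_pos hm]
  refine ⟨(α * δ - β * γ).natAbs, ?_, hq, ?_⟩
  · by_contra hcon
    have h0 : (α * δ - β * γ).natAbs = 0 := by omega
    rw [h0] at hq
    simp at hq
    exact hm.ne' hq
  · intro hq1 u hu
    obtain ⟨x, y, rfl⟩ := hgen u hu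
    have hQ : (α * δ - β * γ) * (α * δ - β * γ) = 1 := by
      rw [← Int.natAbs_mul_self, hq1]; rfl
    have hQ' : ((α : ℝ) * δ - β * γ) * (α * δ - β * γ) = 1 := by exact_mod_cast hQ
    set Q := α * δ - β * γ with hQdef
    refine ⟨Q * (x * δ - y * γ), Q * (y * α - x * β), ?_⟩
    ext
    · simp only [Prod.fst_add, Prod.smul_fst]
      simp only [zsmul_eq_mul, hQdef]
      push_cast
      linear_combination (-(x * v.1 + y * w.1)) * hQ' -
        (α * δ - β * γ) * (x * δ - y * γ) * e1 -  (α * δ - β * γ) * (y * α - x * β) * e3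
    · simp only [Prod.snd_add, Prod.smul_snd]
      simp only [zsmul_eq_mul, hQdef]
      push_cast
      linear_combination (-(x * v.2 + y * w.2)) * hQ' -
        (α * δ - β * γ) * (x * δ - y * γ) * e2 -  (α * δ - β * γ) * (y * α - x * β) * e4

end

theorem natCast_smul_mem {L : Submodule ℤ (ℝ × ℝ)} {b : ℝ} (hb : ((1, b) : ℝ × ℝ) ∈ L) (k : ℕ) :
    ((k, k * b) : ℝ × ℝ) ∈ L := by
  simpa using L.smul_of_tower_mem k hb

section

variable {L : Submodule ℤ (ℝ × ℝ)} [DiscreteTopology L] [IsZLattice ℝ L]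

theorem notMem_rightEdges {j : ℕ}
    (h : ∀ z : ℝ × ℝ, {v | v ∈ L ∧ v - z ∈ unitStair j}.encard = j) {z : ℝ}
    (hz : ∀ t : ℝ, ((0, t) : ℝ × ℝ) ∈ L → z - 2 * j ≤ t → ¬ t < z) (v : ℝ × ℝ) :
    v ∉ rightEdges L j z := by
  have hl : leftEdge L j z = ∅ := by
    ext w
    simp only [Set.mem_empty_iff_false, iff_false]
    rintro ⟨hw, h1, h2, h3⟩
    have : w = (0, w.2) := Prod.ext h1 rfl
    exact hz w.2 (this ▸ hw) h2 h3
  have := ncard_leftEdge_eq h z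
  rw [hl, Set.ncard_empty] at this
  have := (Set.ncard_eq_zero (rightEdges_finite j z)).mp this.symm
  rw [this]
  exact Set.notMem_empty v

/-- If `0` were the only vertical vector, the left edge would be empty for `z ≤ 0` and for `z > 2
j`. The right edges then force `1 + b ≥ 1` from `(1, b)` and `2 j (1 + b) ≤ 2 j` from its multiple
by `2 j`, so `b = 0`, which is excluded. -/
theorem exists_vertical {j : ℕ} (hj : 1 ≤ j)
    (h : ∀ z : ℝ × ℝ, {v | v ∈ L ∧ v - z ∈ unitStair j}.encard = j) {b : ℝ}
    (hb : ((1, b) : ℝ × ℝ) ∈ L) : ∃ t : ℝ, t ≠ 0 ∧ ((0, t) : ℝ × ℝ) ∈ L := by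
  by_contra! hcon
  have hj1 : (1 : ℝ) ≤ j := by exact_mod_cast hj
  have h0 : ∀ t : ℝ, ((0, t) : ℝ × ℝ) ∈ L → t = 0 := fun t ht => by
    by_contra hne
    exact hcon t hne ht
  have key : ∀ i : ℕ, 1 ≤ i → i ≤ 2 * j → ∀ z : ℝ, (z ≤ 0 ∨ 2 * j < z) → z ≤ i + i * b →
      ¬ (i + i * b < z + 1) := by
    intro i h1 h2 z hz h3 h4
    refine notMem_rightEdges h (z := z) (fun t ht h5 h6 => ?_) (i, i * b)
      ⟨natCast_smul_mem hb i, ⟨i, h1, h2, rfl⟩, h3, h4⟩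
    rw [h0 t ht] at h5 h6
    rcases hz with hz | hz <;> linarith
  have hlo : 1 ≤ 1 + b := by
    by_contra! hlt
    have := key 1 le_rfl (by omega) (min 0 (1 + b)) (Or.inl (min_le_left _ _))
    simp only [Nat.cast_one, one_mul] at this
    refine this (min_le_right _ _) ?_
    rcases min_cases 0 (1 + b) with ⟨h1, -⟩ | ⟨h1, -⟩ <;> rw [h1] <;> linarith
  have hhi : (2 * j : ℕ) + (2 * j : ℕ) * b ≤ 2 * j := by
    by_contra! hlt
    exact key (2 * j) (by omega) le_rfl _ (Or.inr hlt) le_rfl (lt_add_one _)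
  push_cast at hhi
  have hb0 : b = 0 := by
    have h1 : 0 ≤ b := by linarith
    have h2 : (2 * j : ℝ) * b ≤ 0 := by linarith
    by_contra hne
    have : 0 < (2 * j : ℝ) * b := mul_pos (by linarith) (lt_of_le_of_ne h1 (Ne.symm hne))
    linarith
  rw [hb0] at hb
  exact one_zero_notMem hj h hb

/-- A lattice whose staircase is the unit staircase is generated by `(0, n)`, `n = 2 j + 1`, and a
vector `(1, b)`. -/
theorem exists_generators {j : ℕ} (hj : 1 ≤ j)
    (h : ∀ z : ℝ × ℝ, {v | v ∈ L ∧ v - z ∈ unitStair j}.encard = j)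
    (hcov : ZLattice.covolume L = 2 * j + 1) {b₀ : ℝ} (hb₀ : ((1, b₀) : ℝ × ℝ) ∈ L) :
    ∃ b : ℝ, ((1, b) : ℝ × ℝ) ∈ L ∧ ((0, 2 * j + 1) : ℝ × ℝ) ∈ L ∧
      (∀ u ∈ L, ∃ k l : ℤ, u = ((k : ℝ), k * b + l * (2 * j + 1))) ∧
      ∀ v ∈ L, ∀ i : ℕ, 1 ≤ i → i ≤ 2 * j → v.1 = i → 2 * j < v.1 + v.2 →
        2 * j + 2 ≤ v.1 + v.2 := by
  have hj1 : (1 : ℝ) ≤ j := by exact_mod_cast hj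
  obtain ⟨t, ht, htL⟩ := exists_vertical hj h hb₀
  obtain ⟨m, hm0, hmL, hmgen⟩ := exists_vertical_generator ht htL
  set b := toIocMod hm0 (-1) b₀ with hbdef
  have hbIoc : b ∈ Set.Ioc (-1) (-1 + m) := toIocMod_mem_Ioc hm0 (-1) b₀
  have hb : ((1, b) : ℝ × ℝ) ∈ L := by
    have := sub_mem hb₀ (L.smul_mem (toIocDiv hm0 (-1) b₀) hmL)
    have he : ((1, b) : ℝ × ℝ) = (1, b₀) - toIocDiv hm0 (-1) b₀ • (0, m) := by
      ext
      · simp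
      · simp only [Prod.snd_sub, Prod.smul_snd]; rfl
    rwa [he]
  obtain ⟨q, hq1, hmq, hgen⟩ := exists_index hm0 hb hmL
  rw [hcov] at hmq
  have hq1' : (1 : ℝ) ≤ q := by exact_mod_cast hq1
  have hmn : 2 * (j : ℝ) + 1 ≤ m := by
    rw [hmq]; nlinarith
  -- For `2 j < z ≤ m` the left edge lies strictly between the consecutive vertical vectors `0` and
  -- `(0, m)`, so the right edges are empty.
  have hgap : ∀ v ∈ L, ∀ i : ℕ, 1 ≤ i → i ≤ 2 * j → v.1 = i → 2 * j < v.1 + v.2 →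
      m + 1 ≤ v.1 + v.2 := by
    intro v hv i h1 h2 h3 h4
    by_contra! hlt
    refine notMem_rightEdges h (z := min (v.1 + v.2) m) (fun t ht h5 h6 => ?_) v
      ⟨hv, ⟨i, h1, h2, h3⟩, min_le_left _ _, ?_⟩
    · obtain ⟨k, rfl⟩ := hmgen t ht
      have h7 : 2 * (j : ℝ) < min (v.1 + v.2) m := lt_min h4 (by linarith)
      have h8 : 0 < k * m := by linarith
      have h9 : k * m < 1 * m := by
        rw [one_mul]; exact h6.trans_le (min_le_right _ _)
      have h10 : (0 : ℝ) < k := (mul_pos_iff_of_pos_right hm0).mp h8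
      have h11 : (k : ℝ) < 1 := lt_of_mul_lt_mul_right h9 hm0.le
      have h10 : 0 < k := by exact_mod_cast h10
      have h11 : k < 1 := by exact_mod_cast h11
      omega
    · rcases min_cases (v.1 + v.2) m with ⟨h7, -⟩ | ⟨h7, -⟩ <;> rw [h7] <;> linarith
  have he1 : 1 ≤ 1 + b := by
    by_contra! hlt
    have := hgap (1, b + m) (by simpa using add_mem hb hmL) 1 le_rfl (by omega) (by simp)
      (by simp only; linarith [hbIoc.1])
    simp only at this
    linarith
  have he2 : 1 + b ≤ 2 * j := by
    by_contra! hlt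
    have := hgap (1, b) hb 1 le_rfl (by omega) (by simp) hlt
    simp only at this
    linarith [hbIoc.2]
  have he3 : 1 < 1 + b := by
    refine lt_of_le_of_ne he1 fun h1 => ?_
    have : b = 0 := by linarith
    rw [this] at hb
    exact one_zero_notMem hj h hb
  have hq : q = 1 := by
    -- This is the first multiple of `1 + b` beyond `2 j`. It is at most `4 j`, whereas `hgap` puts
    -- it at or beyond `q (2 j + 1) + 1`, which exceeds `4 j` once `q ≥ 2`.
    set i := ⌊2 * j / (1 + b)⌋₊ + 1 with hi
    have hpos : 0 < 1 + b := by linarith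
    have h1 : (i : ℝ) * (1 + b) ≤ 2 * j + (1 + b) := by
      have := Nat.floor_le (show 0 ≤ 2 * (j : ℝ) / (1 + b) by positivity)
      rw [le_div_iff₀ hpos] at this
      rw [hi]; push_cast; linarith
    have h2 : 2 * (j : ℝ) < i * (1 + b) := by
      have := Nat.lt_floor_add_one (2 * (j : ℝ) / (1 + b))
      rw [div_lt_iff₀ hpos] at this
      rw [hi]; push_cast; exact this
    have h3 : i ≤ 2 * j := by
      have h4 : 2 * (j : ℝ) / (1 + b) < (2 * j : ℕ) := by
        rw [div_lt_iff₀ hpos]; push_cast; nlinarith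
      have := (Nat.floor_lt (by positivity)).mpr h4
      omega
    have h4 := hgap _ (natCast_smul_mem hb i) i (by omega) h3 rfl (by simp only; linarith)
    simp only at h4
    by_contra hne
    have h5 : 2 ≤ q := by omega
    have h5 : (2 : ℝ) ≤ q := by exact_mod_cast h5
    nlinarith
  have hmn : m = 2 * j + 1 := by rw [hmq, hq]; simp
  rw [hmn] at hmL
  refine ⟨b, hb, hmL, fun u hu => ?_, fun v hv i h1 h2 h3 h4 => ?_⟩
  · rw [← hmn]; exact hgen hq u hu
  · have := hgap v hv i h1 h2 h3 h4
    linarith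

/-- The lattices whose staircase is the unit staircase. -/
theorem exists_congruenceLattice {j : ℕ} (hj : 1 ≤ j) (hst : stair L j = unitStair j)
    (hcov : ZLattice.covolume L = 2 * j + 1) :
    ∃ c : ZMod (2 * j + 1), (IsUnit c ∧ IsUnit (c + 1)) ∧ congruenceLattice (2 * j + 1) c = L := by
  have h := encard_translate_of_encard_coset (fun z => hst ▸ encard_coset_stair L j z)
  obtain ⟨v₀, hv₀, hv₀1⟩ := exists_fst_eq_one hj hst
  obtain ⟨b, hb, hn, hgen, hgap⟩ := exists_generators hj h hcov (b₀ := v₀.2)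
    ((Prod.ext hv₀1 rfl : v₀ = (1, v₀.2)) ▸ hv₀)
  have hj1 : (1 : ℝ) ≤ j := by exact_mod_cast hj
  -- Vertical vectors are multiples of `2 j + 1`, so for these `z` the left edge contains only `0`.
  have hone : ∀ z : ℝ, 0 < z → z ≤ 2 * j → (rightEdges L j z).ncard = 1 := by
    intro z h1 h2
    rw [← ncard_leftEdge_eq h z, Set.ncard_eq_one]
    refine ⟨0, ?_⟩
    ext v
    simp only [Set.mem_singleton_iff]
    constructor
    · rintro ⟨hv, h3, h4, h5⟩
      obtain ⟨k, l, rfl⟩ := hgen v hv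
      simp only at h3 h4 h5
      rw [h3, zero_mul, zero_add] at h4 h5
      have h6 : (-1 : ℝ) < l := by
        by_contra! hcon
        nlinarith
      have h7 : (l : ℝ) < 1 := by
        by_contra! hcon
        nlinarith
      have h6 : -1 < l := by exact_mod_cast h6
      have h7 : l < 1 := by exact_mod_cast h7
      have h8 : l = 0 := by omega
      rw [h3, h8]; simp
    · rintro rfl
      exact ⟨zero_mem _, rfl, by simpa using h2, by simpa using h1⟩
  -- Downward induction on `k`. For `k = 2 j` the gap excludes sums strictly between `2 j` and `2 j
  -- + 2`. For smaller `k`, a sum strictly between `k` and `k + 1` would put two vectors in one set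
  -- of right edges.
  have hint : ∀ k : ℕ, 1 ≤ k → k ≤ 2 * j →
      ∃ v ∈ L, ∃ i : ℕ, 1 ≤ i ∧ i ≤ 2 * j ∧ v.1 = i ∧ v.1 + v.2 = k := by
    suffices hd : ∀ d k : ℕ, k + d = 2 * j → 1 ≤ k →
        ∃ v ∈ L, ∃ i : ℕ, 1 ≤ i ∧ i ≤ 2 * j ∧ v.1 = i ∧ v.1 + v.2 = k from
      fun k h1 h2 => hd (2 * j - k) k (by omega) h1
    intro d
    induction d with
    | zero =>
      rintro k hk h1
      have hkr : (k : ℝ) = 2 * j := by exact_mod_cast hk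
      obtain ⟨v, hv⟩ := Set.ncard_eq_one.mp (hone (2 * j) (by linarith) le_rfl)
      obtain ⟨hvL, ⟨i, hi1, hi2, hi⟩, h2, h3⟩ : v ∈ rightEdges L j (2 * j) := by simp [hv]
      refine ⟨v, hvL, i, hi1, hi2, hi, ?_⟩
      rw [hkr]
      refine le_antisymm ?_ h2
      by_contra! hcon
      have := hgap v hvL i hi1 hi2 hi hcon
      linarith
    | succ d ih =>
      rintro k hk h1
      obtain ⟨w, hwL, i', hi1', hi2', hi', hw⟩ := ih (k + 1) (by omega) (by omega)
      have hk1 : (1 : ℝ) ≤ k := by exact_mod_cast h1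
      have hk2 : (k : ℝ) + 1 ≤ 2 * j := by
        have : k + 1 ≤ 2 * j := by omega
        exact_mod_cast this
      obtain ⟨v, hv⟩ := Set.ncard_eq_one.mp (hone k (by linarith) (by linarith))
      obtain ⟨hvL, ⟨i, hi1, hi2, hi⟩, h2, h3⟩ : v ∈ rightEdges L j k := by simp [hv]
      refine ⟨v, hvL, i, hi1, hi2, hi, le_antisymm ?_ h2⟩
      by_contra! hcon
      push_cast at hw
      obtain ⟨u, hu⟩ := Set.ncard_eq_one.mp
        (hone (v.1 + v.2) (by linarith) (by linarith))
      have hvu : v ∈ rightEdges L j (v.1 + v.2) :=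
        ⟨hvL, ⟨i, hi1, hi2, hi⟩, le_rfl, lt_add_one _⟩
      have hwu : w ∈ rightEdges L j (v.1 + v.2) :=
        ⟨hwL, ⟨i', hi1', hi2', hi'⟩, by linarith, by linarith⟩
      rw [hu, Set.mem_singleton_iff] at hvu hwu
      rw [hwu, ← hvu] at hw
      linarith
  -- Vectors with equal abscissa differ by a multiple of `(0, 2 j + 1)`, so different sums in `1, …,
  -- 2 j` use different abscissas. All abscissas occur by pigeonhole, in particular `1`, with an
  -- integer sum.
  have hbint : ∃ b' : ℤ, b = b' := by
    have hint' : ∀ k : Fin (2 * j), ∃ i : Fin (2 * j), ∃ v ∈ L, v.1 = ((i : ℕ) : ℝ) + 1 ∧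
        v.1 + v.2 = ((k : ℕ) : ℝ) + 1 := by
      intro k
      obtain ⟨v, hv, i, h1, h2, h3, h4⟩ := hint (k + 1) (by omega) (by omega)
      refine ⟨⟨i - 1, by omega⟩, v, hv, ?_, by rw [h4]; push_cast; rfl⟩
      rw [h3]; push_cast [h1]; ring
    choose κ w hw hw1 hw2 using hint'
    have hinj : Function.Injective κ := by
      intro a a' haa
      have hd := sub_mem (hw a) (hw a')
      obtain ⟨k, l, hkl⟩ := hgen _ hd
      have e1 := congrArg Prod.fst hkl
      have e2 := congrArg Prod.snd hkl
      simp only [Prod.fst_sub, Prod.snd_sub] at e1 e2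
      rw [hw1, hw1, haa, sub_self] at e1
      rw [← e1, zero_mul, zero_add] at e2
      have e3 : ((a : ℕ) : ℝ) - (a' : ℕ) = l * (2 * j + 1) := by
        rw [← e2]
        have := hw1 a; have := hw1 a'; have := hw2 a; have := hw2 a'
        rw [haa] at *
        linarith
      have e4 : ((a : ℕ) : ℤ) - (a' : ℕ) = l * (2 * j + 1) := by exact_mod_cast e3
      have := a.2
      have := a'.2
      ext
      have h5 : l = 0 := by
        by_contra hl
        rcases lt_or_gt_of_ne hl with hl | hl <;> nlinarith
      rw [h5] at e4
      omega
    obtain ⟨a, ha⟩ := (Finite.injective_iff_surjective.mp hinj) ⟨0, by omega⟩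
    obtain ⟨k, l, hkl⟩ := hgen _ (hw a)
    have e1 := congrArg Prod.fst hkl
    have e2 := congrArg Prod.snd hkl
    have e3 := hw1 a
    have e4 := hw2 a
    rw [ha] at e3
    simp only [Nat.cast_zero, zero_add] at e1 e2 e3
    rw [← e1, e3, one_mul] at e2
    refine ⟨(a : ℕ) - l * (2 * j + 1), ?_⟩
    push_cast
    linarith
  obtain ⟨b', rfl⟩ := hbint
  have hzn : ((2 * (j : ℤ) + 1 : ℤ) : ZMod (2 * j + 1)) = 0 := by
    have := ZMod.natCast_self (2 * j + 1)
    push_cast at this ⊢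
    exact this
  push_cast at hzn
  have heq : congruenceLattice (2 * j + 1) (b' : ZMod (2 * j + 1)) = L := by
    ext u
    rw [mem_congruenceLattice]
    constructor
    · rintro ⟨x, y, rfl, hxy⟩
      have : ((y - b' * x : ℤ) : ZMod (2 * j + 1)) = 0 := by push_cast; rw [hxy]; ring
      rw [ZMod.intCast_zmod_eq_zero_iff_dvd] at this
      obtain ⟨l, hl⟩ := this
      have h1 := add_mem (L.smul_mem x hb) (L.smul_mem l hn)
      have h2 : (y : ℝ) - b' * x = (2 * j + 1) * l := by exact_mod_cast hl
      convert h1 using 1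
      ext
      · simp
      · simp; linarith
    · intro hu
      obtain ⟨k, l, rfl⟩ := hgen u hu
      refine ⟨k, k * b' + l * (2 * j + 1), by push_cast; rfl, ?_⟩
      push_cast
      rw [hzn]; ring
  -- A vector with ordinate `1` inverts `c`; one with coordinate sum `1` inverts `c + 1`.
  refine ⟨b', ⟨?_, ?_⟩, heq⟩
  · obtain ⟨v, hv, hv2⟩ := exists_snd_eq_one hj hst
    rw [← heq, mem_congruenceLattice] at hv
    obtain ⟨x, y, rfl, hxy⟩ := hv
    have : y = 1 := by simpa using hv2
    rw [this, Int.cast_one] at hxy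
    exact IsUnit.of_mul_eq_one _ hxy.symm
  · obtain ⟨v, hv, i, -, -, hi, hi1⟩ := hint 1 le_rfl (by omega)
    rw [← heq, mem_congruenceLattice] at hv
    obtain ⟨x, y, rfl, hxy⟩ := hv
    have : x + y = 1 := by
      simp only [Nat.cast_one] at hi1
      exact_mod_cast hi1
    have h1 : (x : ZMod (2 * j + 1)) + y = 1 := by exact_mod_cast congrArg (Int.cast) this
    refine IsUnit.of_mul_eq_one (x : ZMod (2 * j + 1)) ?_
    linear_combination h1 - hxy

end

/-! ### Equidistribution of residues in the discrete triangle. -/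

section Counting

variable {j : ℕ}

theorem two_mul_natCast_zmod (j : ℕ) : (2 * (j : ZMod (2 * j + 1))) + 1 = 0 := by
  have := ZMod.natCast_self (2 * j + 1)
  push_cast at this
  exact this

/-- The numbers `1, …, 2 j` represent every nonzero residue exactly once. -/
theorem sum_ite_succ_eq (t : ZMod (2 * j + 1)) :
    ∑ i ∈ Finset.range (2 * j), (if (i : ZMod (2 * j + 1)) + 1 = t then 1 else 0) =
      if t = 0 then 0 else 1 := by
  have h1 : ∑ i ∈ Finset.range (2 * j + 1), (if (i : ZMod (2 * j + 1)) = t then 1 else 0) = 1 := by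
    rw [Finset.sum_eq_single t.val]
    · simp
    · intro b hb hbt
      rw [if_neg]
      intro h
      apply hbt
      rw [← h, ZMod.val_natCast_of_lt (Finset.mem_range.mp hb)]
    · intro h
      exact absurd (Finset.mem_range.mpr (ZMod.val_lt t)) h
  rw [Finset.sum_range_succ'] at h1
  push_cast at h1
  by_cases ht : t = 0
  · rw [if_pos ht]
    rw [if_pos ht.symm] at h1
    omega
  · rw [if_neg ht]
    rw [if_neg (Ne.symm ht)] at h1
    omega

/-- The number of points of a residue class in the discrete triangle `i + k < N`. -/
def triangleCount (c : ZMod (2 * j + 1)) (N : ℕ) (r : ZMod (2 * j + 1)) : ℕ :=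
  ∑ i ∈ Finset.range N, ∑ k ∈ Finset.range (N - i),
    if (k : ZMod (2 * j + 1)) - c * i = r then 1 else 0

/-- This splits off the column `i = 0`; shifting the other columns left changes the residue by `c`.
-/
theorem triangleCount_succ (c : ZMod (2 * j + 1)) (N : ℕ) (r : ZMod (2 * j + 1)) :
    triangleCount c (N + 1) r = triangleCount c N (r + c) +
      ∑ k ∈ Finset.range (N + 1), if (k : ZMod (2 * j + 1)) + 1 = r + 1 then 1 else 0 := by
  rw [triangleCount, Finset.sum_range_succ', triangleCount]
  congr 1
  · refine Finset.sum_congr rfl fun i _ => ?_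
    rw [Nat.add_sub_add_right]
    refine Finset.sum_congr rfl fun k _ => ?_
    refine if_congr ?_ rfl rfl
    push_cast
    constructor <;> intro h <;> linear_combination h
  · simp

/-- This splits off the diagonal `i + k = N` instead. -/
theorem triangleCount_succ' (c : ZMod (2 * j + 1)) (N : ℕ) (r : ZMod (2 * j + 1)) :
    triangleCount c (N + 1) r = triangleCount c N r +
      ∑ i ∈ Finset.range (N + 1), if (N : ZMod (2 * j + 1)) - (1 + c) * i = r then 1 else 0 := by
  have h1 : ∀ i ∈ Finset.range (N + 1), (∑ k ∈ Finset.range (N + 1 - i),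
      if (k : ZMod (2 * j + 1)) - c * i = r then 1 else 0) =
      (∑ k ∈ Finset.range (N - i), if (k : ZMod (2 * j + 1)) - c * i = r then 1 else 0) +
      if (N : ZMod (2 * j + 1)) - (1 + c) * i = r then 1 else 0 := by
    intro i hi
    have hi : i ≤ N := by
      have := Finset.mem_range.mp hi
      omega
    rw [Nat.succ_sub hi, Finset.sum_range_succ, Nat.cast_sub hi]
    congr 1
    refine if_congr ?_ rfl rfl
    constructor <;> intro h <;> linear_combination h
  rw [triangleCount, Finset.sum_congr rfl h1, Finset.sum_add_distrib, triangleCount,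
    Finset.sum_range_succ (fun i => ∑ k ∈ Finset.range (N - i), _) N]
  simp

/-- The residue classes are equidistributed in the discrete triangle. -/
theorem triangleCount_eq {c : ZMod (2 * j + 1)} (hc : IsUnit c)
    (hc1 : IsUnit (c + 1)) (r : ZMod (2 * j + 1)) : triangleCount c (2 * j) r = j := by
  rcases Nat.eq_zero_or_pos j with rfl | hj
  · simp [triangleCount]
  obtain ⟨N, hN⟩ : ∃ N, 2 * j = N + 1 := ⟨2 * j - 1, by omega⟩
  have hNc : (N : ZMod (2 * j + 1)) = -2 := by
    have h1 := two_mul_natCast_zmod j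
    have h2 : (2 * (j : ZMod (2 * j + 1))) = N + 1 := by exact_mod_cast congrArg Nat.cast hN
    rw [h2] at h1
    linear_combination h1
  -- Both counts are `triangleCount c N (r + c)` plus the contribution of a column or of a diagonal.
  -- As `c + 1` is a unit and `N = -2`, each contribution is `1` unless `r = -1`. Since `c` is a
  -- unit, invariance under it makes the count constant.
  have hshift : ∀ r, triangleCount c (2 * j) (r + c) = triangleCount c (2 * j) r := by
    intro r
    obtain ⟨u, hu⟩ := hc1
    have h1 := triangleCount_succ c N r
    have h2 := triangleCount_succ' c N (r + c)
    rw [← hN] at h1 h2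
    rw [h1, h2, sum_ite_succ_eq]
    congr 1
    have h3 := sum_ite_succ_eq (j := j) (-(↑u⁻¹ * (r + 1)))
    rw [show (if r + 1 = 0 then 0 else 1) = if -(↑u⁻¹ * (r + 1)) = 0 then 0 else 1 by simp, ← h3]
    refine Finset.sum_congr rfl fun i _ => if_congr ?_ rfl rfl
    have hu1 : (u : ZMod (2 * j + 1)) * ↑u⁻¹ = 1 := u.mul_inv
    rw [hu] at hu1
    constructor
    · intro h
      rw [hNc] at h
      linear_combination (-(↑u⁻¹ : ZMod (2 * j + 1))) * h - (i + 1) * hu1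
    · intro h
      rw [hNc]
      linear_combination (-(c + 1)) * h + (r + 1) * hu1
  have hconst : ∀ (m : ℕ) r, triangleCount c (2 * j) (r + m * c) = triangleCount c (2 * j) r := by
    intro m r
    induction m with
    | zero => simp
    | succ m ih => rw [← ih, ← hshift (r + m * c)]; congr 1; push_cast; ring
  have hall : ∀ r, triangleCount c (2 * j) r = triangleCount c (2 * j) 0 := by
    intro r
    obtain ⟨u, rfl⟩ := hc
    have := hconst (r * ↑u⁻¹).val 0
    rw [ZMod.natCast_zmod_val, zero_add, mul_assoc, u.inv_mul, mul_one] at this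
    exact this
  have htot : ∑ r : ZMod (2 * j + 1), triangleCount c (2 * j) r = j * (2 * j + 1) := by
    simp only [triangleCount]
    rw [Finset.sum_comm]
    have h1 : ∀ i ∈ Finset.range (2 * j), (∑ r : ZMod (2 * j + 1), ∑ k ∈ Finset.range (2 * j - i),
        if (k : ZMod (2 * j + 1)) - c * i = r then 1 else 0) = 2 * j - i := by
      intro i _
      rw [Finset.sum_comm]
      simp
    rw [Finset.sum_congr rfl h1]
    have h2 : ∑ i ∈ Finset.range (2 * j), (2 * j - i) = ∑ i ∈ Finset.range (2 * j), (i + 1) := by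
      rw [← Finset.sum_range_reflect]
      refine Finset.sum_congr rfl fun i hi => ?_
      have := Finset.mem_range.mp hi
      omega
    have h3 := Finset.sum_range_succ' (fun i => i) (2 * j)
    rw [add_zero] at h3
    rw [h2, ← h3]
    have := Finset.sum_range_id_mul_two (2 * j + 1)
    simp only [Nat.add_sub_cancel] at this
    nlinarith
  rw [Finset.sum_congr rfl fun r _ => hall r, Finset.sum_const, Finset.card_univ, ZMod.card,
    smul_eq_mul, mul_comm] at htot
  rw [hall r]
  exact Nat.eq_of_mul_eq_mul_right (by omega) htot

/-- The unit staircase meets each coset of a congruence lattice in exactly `j` points. -/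
theorem encard_congruenceLattice {c : ZMod (2 * j + 1)} (hc : IsUnit c) (hc1 : IsUnit (c + 1))
    (z : ℝ × ℝ) :
    {v | v ∈ congruenceLattice (2 * j + 1) c ∧ v - z ∈ unitStair j}.encard = j := by
  classical
  set r : ZMod (2 * j + 1) := c * (⌈z.1⌉ : ℤ) - (⌈z.2⌉ : ℤ) with hr
  set P : Finset (Σ _ : ℕ, ℕ) := ((Finset.range (2 * j)).sigma fun i =>
    Finset.range (2 * j - i)).filter fun p => (p.2 : ZMod (2 * j + 1)) - c * p.1 = r with hP
  have hcard : P.card = j := by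
    rw [hP, Finset.card_filter, Finset.sum_sigma]
    exact triangleCount_eq hc hc1 r
  let f : (Σ _ : ℕ, ℕ) → ℝ × ℝ := fun p => ((⌈z.1⌉ : ℝ) + p.1, (⌈z.2⌉ : ℝ) + p.2)
  have hf : Function.Injective f := by
    rintro ⟨a, b⟩ ⟨a', b'⟩ h
    simp only [f, Prod.mk.injEq, add_right_inj, Nat.cast_inj] at h
    rw [h.1, h.2]
  have himg : {v | v ∈ congruenceLattice (2 * j + 1) c ∧ v - z ∈ unitStair j} =
      f '' (P : Set (Σ _ : ℕ, ℕ)) := by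
    have hz1 := Int.le_ceil z.1
    have hz2 := Int.le_ceil z.2
    have hz3 := Int.ceil_lt_add_one z.1
    have hz4 := Int.ceil_lt_add_one z.2
    ext v
    constructor
    · rintro ⟨⟨x, y, rfl, hxy⟩, i, hi, h1, h2, h3, h4⟩
      simp only [Prod.fst_sub, Prod.snd_sub] at h1 h2 h3 h4
      have hx : x = ⌈z.1⌉ + i := by
        have e1 : (x : ℝ) < ⌈z.1⌉ + i + 1 := by linarith
        have e2 : (⌈z.1⌉ : ℝ) + i < x + 1 := by linarith
        have e1 : x < ⌈z.1⌉ + i + 1 := by exact_mod_cast e1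
        have e2 : ⌈z.1⌉ + i < x + 1 := by exact_mod_cast e2
        omega
      have hy0 : 0 ≤ y - ⌈z.2⌉ := sub_nonneg.mpr (Int.ceil_le.mpr (by linarith))
      obtain ⟨k, hk⟩ := Int.eq_ofNat_of_zero_le hy0
      have hy : y = ⌈z.2⌉ + k := by omega
      refine ⟨⟨i, k⟩, ?_, ?_⟩
      · rw [hP, Finset.mem_coe, Finset.mem_filter, Finset.mem_sigma, Finset.mem_range,
          Finset.mem_range]
        refine ⟨⟨hi, ?_⟩, ?_⟩
        · rw [hy] at h4
          push_cast at h4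
          have e1 : (k : ℝ) + i < 2 * j := by linarith
          have e1 : k + i < 2 * j := by exact_mod_cast e1
          simp only
          omega
        · rw [hx, hy] at hxy
          push_cast at hxy
          simp only [hr]
          linear_combination hxy
      · simp only [f, hx, hy]
        push_cast
        rfl
    · rintro ⟨⟨i, k⟩, hp, rfl⟩
      rw [hP, Finset.mem_coe, Finset.mem_filter, Finset.mem_sigma, Finset.mem_range,
        Finset.mem_range] at hp
      obtain ⟨⟨hi, hk⟩, hp⟩ := hp
      simp only at hi hk hp
      refine ⟨⟨⌈z.1⌉ + i, ⌈z.2⌉ + k, by simp [f], ?_⟩, i, hi, ?_⟩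
      · push_cast
        rw [hr] at hp
        linear_combination hp
      · have hki : (k : ℝ) + i + 1 ≤ 2 * j := by
          have : k + i + 1 ≤ 2 * j := by omega
          exact_mod_cast this
        have hk0 : (0 : ℝ) ≤ k := by positivity
        simp only [f, Prod.fst_sub, Prod.snd_sub]
        refine ⟨?_, ?_, ?_, ?_⟩ <;> linarith
  rw [himg, hf.encard_image, Set.encard_coe_eq_coe_finsetCard, hcard]

end Counting

/-! ### Congruence lattices realise the extremal covolume. -/

instance congruenceLattice_discrete (n : ℕ) (c : ZMod n) :
    DiscreteTopology (congruenceLattice n c) := by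
  have hsub : (congruenceLattice n c : Set (ℝ × ℝ)) ⊆
      (span ℤ (Set.range (Module.Basis.finTwoProd ℝ)) : Set (ℝ × ℝ)) := by
    rintro _ ⟨a, b, rfl, -⟩
    have h0 : Module.Basis.finTwoProd ℝ 0 ∈ span ℤ (Set.range (Module.Basis.finTwoProd ℝ)) :=
      subset_span ⟨0, rfl⟩
    have h1 : Module.Basis.finTwoProd ℝ 1 ∈ span ℤ (Set.range (Module.Basis.finTwoProd ℝ)) :=
      subset_span ⟨1, rfl⟩
    have := add_mem (smul_mem _ a h0) (smul_mem _ b h1)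
    simpa using this
  have : DiscreteTopology (span ℤ (Set.range (Module.Basis.finTwoProd ℝ))) := inferInstance
  exact DiscreteTopology.of_subset this hsub

instance congruenceLattice_isZLattice (n : ℕ) [NeZero n] (c : ZMod n) :
    IsZLattice ℝ (congruenceLattice n c) where
  span_top := by
    have hn : (n : ℝ) ≠ 0 := Nat.cast_ne_zero.mpr (NeZero.ne n)
    refine eq_top_iff.mpr fun x _ => ?_
    have h0 : (((n : ℤ) : ℝ), ((0 : ℤ) : ℝ)) ∈ congruenceLattice n c := ⟨n, 0, rfl, by simp⟩
    have h1 : (((0 : ℤ) : ℝ), ((n : ℤ) : ℝ)) ∈ congruenceLattice n c := ⟨0, n, rfl, by simp⟩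
    have := add_mem (smul_mem _ (x.1 / n) (subset_span (R := ℝ) h0))
      (smul_mem _ (x.2 / n) (subset_span (R := ℝ) h1))
    convert this using 1
    ext <;> simp [hn]

theorem congruenceLattice_injective (n : ℕ) [NeZero n] :
    Function.Injective (congruenceLattice n) := by
  intro c c' h
  have h1 : ((((1 : ℤ) : ℝ), ((c.val : ℤ) : ℝ)) : ℝ × ℝ) ∈ congruenceLattice n c :=
    ⟨1, c.val, rfl, by simp⟩
  rw [h, mem_congruenceLattice] at h1
  obtain ⟨a, b, he, hab⟩ := h1
  rw [Prod.mk.injEq, Int.cast_inj, Int.cast_inj] at he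
  rw [← he.1, ← he.2] at hab
  simpa using hab

theorem volume_unitStair (j : ℕ) : MeasurableSet (unitStair j) ∧
    volume (unitStair j) = ENNReal.ofReal (j * (2 * j + 1)) := by
  have h := volume_steps (x := fun i => (i : ℝ)) (y := fun i => ((2 * j - i : ℕ) : ℝ))
    Nat.mono_cast (fun i => Nat.cast_nonneg _) (2 * j)
  rw [steps_eq_unitStair (fun i _ => rfl) fun i hi => by rw [Nat.cast_sub hi.le]] at h
  refine ⟨h.1, h.2.trans ?_⟩
  congr 1
  have h1 : ∀ i ∈ Finset.range (2 * j), (((i + 1 : ℕ) : ℝ) - i) * ((2 * j - i : ℕ) : ℝ) =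
      ((2 * j - 1 - i : ℕ) : ℝ) + 1 := by
    intro i hi
    have hi := Finset.mem_range.mp hi
    have : 2 * j - i = (2 * j - 1 - i) + 1 := by omega
    rw [this]; push_cast; ring
  rw [Finset.sum_congr rfl h1, Finset.sum_range_reflect (fun i => (i : ℝ) + 1)]
  clear h h1
  have : ∀ N : ℕ, ∑ i ∈ Finset.range N, ((i : ℝ) + 1) = N * (N + 1) / 2 := by
    intro N
    induction N with
    | zero => simp
    | succ N ih => rw [Finset.sum_range_succ, ih]; push_cast; ring
  rw [this]; push_cast; ring

/-- The unit staircase has area `j (2 j + 1)` and meets every coset in `j` points. -/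
theorem covolume_congruenceLattice {j : ℕ} (hj : 1 ≤ j) {c : ZMod (2 * j + 1)} (hc : IsUnit c)
    (hc1 : IsUnit (c + 1)) : ZLattice.covolume (congruenceLattice (2 * j + 1) c) = 2 * j + 1 := by
  have h := measure_eq_of_encard_coset (congruenceLattice (2 * j + 1) c) volume
    (volume_unitStair j).1 j (fun z => ?_)
  · have hj0 : (0 : ℝ) < j := by exact_mod_cast hj
    rw [(volume_unitStair j).2, ← ENNReal.ofReal_natCast, ← ENNReal.ofReal_mul hj0.le,
      ENNReal.ofReal_eq_ofReal_iff (by positivity)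
        (mul_nonneg hj0.le (ZLattice.covolume_pos _ volume).le)] at h
    exact (mul_left_cancel₀ hj0.ne' h).symm
  · rw [← encard_congruenceLattice hc hc1 (-z)]
    have hinj : Function.Injective (fun v : ℝ × ℝ => v - z) := sub_left_injective
    rw [← hinj.encard_image]
    congr 1
    ext v
    constructor
    · rintro ⟨q, ⟨hq, hqz⟩, rfl⟩
      exact ⟨hqz, by simpa using hq⟩
    · rintro ⟨hv, hvz⟩
      exact ⟨v + z, ⟨by simpa using hvz, by simpa using hv⟩, by simp⟩

theorem openTriangle_subset_unitStair (j : ℕ) : openTriangle (2 * j) ⊆ unitStair j := by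
  rintro p ⟨h1, h2, h3⟩
  rw [mem_unitStair_iff]
  have := Int.floor_le p.1
  exact ⟨h1.le, h2.le, by linarith⟩

theorem unitStair_subset_closedTriangle (j : ℕ) : unitStair j ⊆ closedTriangle (2 * j + 1) := by
  intro p hp
  rw [mem_unitStair_iff] at hp
  have := Int.lt_floor_add_one p.1
  exact ⟨hp.1, hp.2.1, by linarith [hp.2.2]⟩

theorem encard_sub_mem (L : Submodule ℤ (ℝ × ℝ)) (D : Set (ℝ × ℝ)) (z : ℝ × ℝ) :
    {v | v ∈ L ∧ z - v ∈ D}.encard = {v | v ∈ L ∧ v - -z ∈ D}.encard := by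
  rw [← neg_injective.encard_image {v | v ∈ L ∧ z - v ∈ D}]
  congr 1
  ext v
  constructor
  · rintro ⟨w, ⟨hw, hwz⟩, rfl⟩
    exact ⟨neg_mem hw, by rwa [sub_neg_eq_add, neg_add_eq_sub]⟩
  · rintro ⟨hv, hvz⟩
    exact ⟨-v, ⟨neg_mem hv, by rwa [sub_neg_eq_add, add_comm, ← sub_neg_eq_add]⟩, neg_neg v⟩

theorem packing_congruenceLattice {j : ℕ} {c : ZMod (2 * j + 1)} (hc : IsUnit c)
    (hc1 : IsUnit (c + 1)) (z : ℝ × ℝ) :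
    {v | v ∈ congruenceLattice (2 * j + 1) c ∧ z - v ∈ openTriangle (2 * j)}.encard ≤ j := by
  rw [encard_sub_mem, ← encard_congruenceLattice hc hc1 (-z)]
  exact Set.encard_le_encard fun v hv => ⟨hv.1, openTriangle_subset_unitStair j hv.2⟩

theorem covering_congruenceLattice {j : ℕ} {c : ZMod (2 * j + 1)} (hc : IsUnit c)
    (hc1 : IsUnit (c + 1)) (z : ℝ × ℝ) :
    (j : ℕ∞) ≤
      {v | v ∈ congruenceLattice (2 * j + 1) c ∧ z - v ∈ closedTriangle (2 * j + 1)}.encard := by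
  rw [encard_sub_mem, ← encard_congruenceLattice hc hc1 (-z)]
  exact Set.encard_le_encard fun v hv => ⟨hv.1, unitStair_subset_closedTriangle j hv.2⟩

end MultipleLattice

/-! ### The number of residues `c` with `c` and `c + 1` units. -/

namespace MultipleLattice

/-- The number of residues `c` modulo `n` such that `c` and `c + 1` are both units. -/
noncomputable def unitPairCount (n : ℕ) : ℕ := Nat.card {c : ZMod n // IsUnit c ∧ IsUnit (c + 1)}

theorem unitPairCount_mul {m n : ℕ} (h : m.Coprime n) :
    unitPairCount (m * n) = unitPairCount m * unitPairCount n := by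
  rw [unitPairCount, unitPairCount, unitPairCount, ← Nat.card_prod]
  let e := ZMod.chineseRemainder h
  have hu : ∀ x : ZMod (m * n), IsUnit x ↔ IsUnit (e x).1 ∧ IsUnit (e x).2 := fun x => by
    rw [← Prod.isUnit_iff, MulEquiv.isUnit_map]
  have hu1 : ∀ x : ZMod (m * n), IsUnit (x + 1) ↔ IsUnit ((e x).1 + 1) ∧ IsUnit ((e x).2 + 1) :=
    fun x => by rw [hu, map_add, map_one]; rfl
  refine Nat.card_congr ((Equiv.subtypeEquiv e.toEquiv (q := fun y => (IsUnit y.1 ∧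
    IsUnit (y.1 + 1)) ∧ (IsUnit y.2 ∧ IsUnit (y.2 + 1))) fun x => ?_).trans
    (Equiv.subtypeProdEquivProd (p := fun c : ZMod m => IsUnit c ∧ IsUnit (c + 1))
      (q := fun c : ZMod n => IsUnit c ∧ IsUnit (c + 1))))
  rw [hu, hu1]
  exact and_and_and_comm

/-- Modulo a prime power, `c` and `c + 1` are never both non-units, so inclusion–exclusion leaves `2
φ(p ^ k) - p ^ k`. -/
theorem unitPairCount_prime_pow {p k : ℕ} (hp : p.Prime) (hk : 1 ≤ k) :
    (unitPairCount (p ^ k) : ℝ) = p ^ k * (1 - 2 / p) := by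
  classical
  have : NeZero (p ^ k) := ⟨pow_ne_zero _ hp.ne_zero⟩
  have hp0 : (p : ℝ) ≠ 0 := Nat.cast_ne_zero.mpr hp.ne_zero
  have : Fact p.Prime := ⟨hp⟩
  have hloc : ∀ x : ZMod (p ^ k), ¬ IsUnit x → ¬ IsUnit (x + 1) → False := by
    intro x h1 h2
    have hunit : ∀ y : ZMod (p ^ k), ¬ IsUnit y → p ∣ y.val := fun y hy => by
      by_contra hcon
      apply hy
      rw [← ZMod.natCast_zmod_val y, ZMod.isUnit_iff_coprime]
      exact Nat.Coprime.pow_right _ ((Nat.Prime.coprime_iff_not_dvd hp).mpr hcon).symm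
    have hz : ∀ y : ZMod (p ^ k), ¬ IsUnit y →
        ZMod.castHom (dvd_pow_self p (by omega : k ≠ 0)) (ZMod p) y = 0 := fun y hy => by
      rw [← ZMod.natCast_zmod_val y, map_natCast, ZMod.natCast_eq_zero_iff]
      exact hunit y hy
    have h3 := hz _ h2
    rw [map_add, hz _ h1, map_one, zero_add] at h3
    exact one_ne_zero h3
  have hU : (Finset.univ.filter fun c : ZMod (p ^ k) => IsUnit c).card = (p ^ k).totient := by
    rw [← ZMod.card_units_eq_totient, ← Fintype.card_subtype]
    refine (Fintype.card_congr (Equiv.ofBijective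
      (fun u : (ZMod (p ^ k))ˣ => (⟨u, u.isUnit⟩ : {c : ZMod (p ^ k) // IsUnit c}))
      ⟨fun u v h => Units.ext (congrArg Subtype.val h), ?_⟩)).symm
    rintro ⟨_, u, rfl⟩
    exact ⟨u, rfl⟩
  have hN : (Finset.univ.filter fun c : ZMod (p ^ k) => ¬ IsUnit (c + 1)).card =
      (Finset.univ.filter fun c : ZMod (p ^ k) => ¬ IsUnit c).card :=
    Finset.card_bij (fun c _ => c + 1) (by simp) (by simp) fun b hb =>
      ⟨b - 1, by simpa using hb, by simp⟩
  have hsplit := Finset.card_filter_add_card_filter_not (s := (Finset.univ : Finset (ZMod (p ^ k))))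
    (fun c => IsUnit c)
  rw [Finset.card_univ, ZMod.card, hU] at hsplit
  have hU' : (Finset.univ.filter fun c : ZMod (p ^ k) => IsUnit c).card =
      (Finset.univ.filter fun c : ZMod (p ^ k) => IsUnit c ∧ IsUnit (c + 1)).card +
      (Finset.univ.filter fun c : ZMod (p ^ k) => ¬ IsUnit (c + 1)).card := by
    rw [← Finset.card_union_of_disjoint]
    · congr 1
      ext c
      simp only [Finset.mem_filter, Finset.mem_univ, true_and, Finset.mem_union]
      have := hloc c
      tauto
    · rw [Finset.disjoint_filter]
      tauto
  rw [hU, hN] at hU'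
  have hcount : unitPairCount (p ^ k) =
      (Finset.univ.filter fun c : ZMod (p ^ k) => IsUnit c ∧ IsUnit (c + 1)).card := by
    rw [unitPairCount, Nat.card_eq_fintype_card, Fintype.card_subtype]
  have htot : ((p ^ k).totient : ℝ) = p ^ k * (1 - 1 / p) := by
    obtain ⟨l, rfl⟩ : ∃ l, k = l + 1 := ⟨k - 1, by omega⟩
    rw [Nat.totient_prime_pow_succ hp]
    push_cast [hp.one_le]
    field_simp
    ring
  have h1 : (unitPairCount (p ^ k) : ℝ) = 2 * (p ^ k).totient - p ^ k := by
    rw [hcount, eq_sub_iff_add_eq]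
    exact_mod_cast (by omega : _ + p ^ k = 2 * (p ^ k).totient)
  rw [h1, htot]
  ring

theorem unitPairCount_eq {n : ℕ} (hn : n ≠ 0) :
    (unitPairCount n : ℝ) = n * ∏ p ∈ n.primeFactors, (1 - 2 / (p : ℝ)) := by
  induction n using Nat.recOnPosPrimePosCoprime with
  | zero => exact absurd rfl hn
  | one =>
    have : unitPairCount 1 = 1 := by
      rw [unitPairCount, Nat.card_eq_one_iff_unique]
      have : Subsingleton (ZMod 1) := inferInstanceAs (Subsingleton (Fin 1))
      exact ⟨inferInstance, ⟨⟨0, isUnit_of_subsingleton _, isUnit_of_subsingleton _⟩⟩⟩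
    simp [this]
  | prime_pow p k hp hk =>
    rw [unitPairCount_prime_pow hp hk, Nat.primeFactors_prime_pow hk.ne' hp]
    simp
  | coprime a b ha hb hab iha ihb =>
    rw [unitPairCount_mul hab, Nat.cast_mul, iha (by omega), ihb (by omega),
      hab.primeFactors_mul, Finset.prod_union hab.disjoint_primeFactors]
    push_cast
    ring

end MultipleLattice

/-! ### Densities of lattice families. -/

namespace MultipleLattice

open MeasureTheory Submodule Filter Topology
open scoped Pointwise

theorem mem_square_of_norm_le {x : Plane} {r : ℝ} (h : ‖x‖ ≤ r) : x ∈ square r := fun i =>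
  abs_le.mp ((PiLp.norm_apply_le x i).trans h)

theorem square_add {x y : Plane} {a b : ℝ} (hx : x ∈ square a) (hy : y ∈ square b) :
    x + y ∈ square (a + b) := by
  intro i
  have h1 := hx i
  have h2 := hy i
  constructor
  · simp only [PiLp.add_apply]; linarith [h1.1, h2.1]
  · simp only [PiLp.add_apply]; linarith [h1.2, h2.2]

theorem square_neg {x : Plane} {a : ℝ} (hx : x ∈ square a) : -x ∈ square a := by
  intro i
  have h1 := hx i
  constructor
  · simp only [PiLp.neg_apply]; linarith [h1.2]
  · simp only [PiLp.neg_apply]; linarith [h1.1]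

theorem volume_square {l : ℝ} (hl : 0 ≤ l) : volume (square l) = ENNReal.ofReal ((2 * l) ^ 2) := by
  have h : square l = (WithLp.ofLp : Plane → Fin 2 → ℝ) ⁻¹'
      Set.Icc (fun _ => -l) (fun _ => l) := by
    ext x
    simp only [square, Set.mem_ofPred_eq, Set.mem_preimage, Set.mem_Icc, Pi.le_def]
    exact forall_and
  rw [h, (PiLp.volume_preserving_ofLp (Fin 2)).measure_preimage measurableSet_Icc.nullMeasurableSet,
    Real.volume_Icc_pi]
  simp only [Finset.prod_const, Finset.card_univ, Fintype.card_fin]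
  rw [ENNReal.ofReal_pow (by linarith)]
  congr 2
  ring

theorem volume_translates (L : Submodule ℤ Plane) (K : Set Plane) (v : L) : volume (translates K L v) = volume K := by
  rw [translates, Set.image_add_right, measure_preimage_add_right]

theorem tsum_volume_translates (L : Submodule ℤ Plane) (K : Set Plane) (S : Set L) :
    ∑' v : S, volume (translates K L v) = S.encard * volume K := by
  simp_rw [volume_translates]
  rw [ENNReal.tsum_set_const]

section

variable (L : Submodule ℤ Plane) [DiscreteTopology L] [IsZLattice ℝ L]

/-- The number of lattice points in a family of regions that differ boundedly from squares. -/
theorem tendsto_encard_div {V : ℝ → Set L} {ρ : ℝ}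
    (hup : ∀ l, ∀ v ∈ V l, (v : Plane) ∈ square (l + ρ))
    (hlow : ∀ l, ∀ v : L, (v : Plane) ∈ square (l - ρ) → v ∈ V l) {c : ℝ≥0∞} (hc : c ≠ ⊤) :
    Tendsto (fun l : ℝ => ((V l).encard * c : ℝ≥0∞) / volume (square l)) atTop
      (𝓝 (c / ENNReal.ofReal (ZLattice.covolume L))) := by
  have hF := ZLattice.isAddFundamentalDomain (Module.Free.chooseBasis ℤ L)
    (volume : Measure Plane)
  have hb := ZSpan.fundamentalDomain_isBounded ((Module.Free.chooseBasis ℤ L).ofZLatticeBasis ℝ)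
  set F := ZSpan.fundamentalDomain ((Module.Free.chooseBasis ℤ L).ofZLatticeBasis ℝ)
  have : VAddInvariantMeasure L Plane volume :=
    (inferInstance : VAddInvariantMeasure L.toAddSubgroup Plane volume)
  have : MeasurableVAdd L Plane := (inferInstance : MeasurableVAdd L.toAddSubgroup Plane)
  have hfin : volume F < ⊤ := hb.measure_lt_top
  have hcov : ENNReal.ofReal (ZLattice.covolume L) = volume F := by
    rw [ZLattice.covolume_eq_measure_fundamentalDomain L volume hF, Measure.real,
      ENNReal.ofReal_toReal hfin.ne]
  have hF0 : volume F ≠ 0 := by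
    rw [← hcov]
    exact (ENNReal.ofReal_pos.mpr (ZLattice.covolume_pos L volume)).ne'
  obtain ⟨ρ', hρ'⟩ := hb.exists_norm_le
  -- Counting lattice points amounts to measuring the union of their cells, which lies between two
  -- squares of half-sides `l ± (ρ + ρ')` up to a null set.
  have hcount : ∀ l, ((V l).encard : ℝ≥0∞) * volume F = volume (⋃ v ∈ V l, v +ᵥ F) := by
    intro l
    rw [measure_biUnion₀ (Set.to_countable _)]
    · simp_rw [measure_vadd]
      rw [ENNReal.tsum_set_const]
    · exact fun a _ b _ hab => hF.aedisjoint hab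
    · exact fun v _ => hF.nullMeasurableSet_vadd v
  have hle : ∀ l, ((V l).encard : ℝ≥0∞) * volume F ≤ volume (square (l + (ρ + ρ'))) := by
    intro l
    rw [hcount]
    refine measure_mono (Set.iUnion₂_subset fun v hv => ?_)
    rintro _ ⟨f, hf, rfl⟩
    have := square_add (hup l v hv) (mem_square_of_norm_le (hρ' f hf))
    rwa [add_assoc] at this
  have hge : ∀ l, volume (square (l - (ρ + ρ'))) ≤ ((V l).encard : ℝ≥0∞) * volume F := by
    intro l
    rw [hcount]
    refine measure_mono_ae ?_
    filter_upwards [hF.ae_covers] with x ⟨g, hg⟩ hx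
    refine Set.mem_iUnion₂.mpr ⟨-g, hlow l _ ?_, ?_⟩
    · have h1 := square_add hx (square_neg (mem_square_of_norm_le (hρ' _ hg)))
      have h2 : x + -(g +ᵥ x) = ((-g : L) : Plane) := by
        rw [Submodule.vadd_def]; simp
      rw [h2] at h1
      convert h1 using 2
      ring
    · exact ⟨_, hg, neg_vadd_vadd g x⟩
  have hratio : ∀ R : ℝ, Tendsto (fun l : ℝ => ENNReal.ofReal (((l + R) / l) ^ 2)) atTop (𝓝 1) := by
    intro R
    rw [← ENNReal.ofReal_one]
    refine ENNReal.tendsto_ofReal ?_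
    have h1 : Tendsto (fun l : ℝ => 1 + R / l) atTop (𝓝 (1 + 0)) :=
      tendsto_const_nhds.add (tendsto_const_nhds.div_atTop tendsto_id)
    have h2 := h1.pow 2
    rw [add_zero, one_pow] at h2
    refine h2.congr' ?_
    filter_upwards [eventually_gt_atTop 0] with l hl
    congr 1
    field_simp
  have hsq : ∀ R l : ℝ, 0 < l → 0 ≤ l + R →
      volume (square (l + R)) / volume (square l) = ENNReal.ofReal (((l + R) / l) ^ 2) := by
    intro R l hl hR
    rw [volume_square hl.le, volume_square hR, ← ENNReal.ofReal_div_of_pos (by positivity)]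
    congr 1
    field_simp
  have hmain : Tendsto (fun l : ℝ => ((V l).encard * volume F : ℝ≥0∞) / volume (square l)) atTop
      (𝓝 1) := by
    refine tendsto_of_tendsto_of_tendsto_of_le_of_le' (hratio (-(ρ + ρ'))) (hratio (ρ + ρ')) ?_ ?_
    · filter_upwards [eventually_gt_atTop 0, eventually_ge_atTop (ρ + ρ')] with l hl hl'
      rw [← hsq _ l hl (by linarith), ← sub_eq_add_neg]
      exact ENNReal.div_le_div_right (hge l) _
    · filter_upwards [eventually_gt_atTop 0, eventually_ge_atTop (-(ρ + ρ'))] with l hl hl'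
      rw [← hsq _ l hl (by linarith)]
      exact ENNReal.div_le_div_right (hle l) _
  have hne : c / volume F ≠ ⊤ := ENNReal.div_ne_top hc hF0
  have := ENNReal.Tendsto.const_mul (a := c / volume F) hmain (Or.inr hne)
  rw [mul_one] at this
  rw [hcov]
  refine this.congr fun l => ?_
  rw [← mul_div_assoc]
  congr 1
  rw [mul_comm, mul_assoc, ENNReal.mul_div_cancel hF0 hfin.ne]

variable {K : Set Plane}

/-- Meeting the square and lying in it differ only for translates in a border of bounded width, so
both densities are limits with the same value. -/
theorem density_translates (hK : Bornology.IsBounded K) (hne : K.Nonempty) :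
    upperDensity (translates K L) = volume K / ENNReal.ofReal (ZLattice.covolume L) ∧
    lowerDensity (translates K L) = volume K / ENNReal.ofReal (ZLattice.covolume L) := by
  obtain ⟨ρ, hρ⟩ := hK.exists_norm_le
  have hfin : volume K ≠ ⊤ := hK.measure_lt_top.ne
  obtain ⟨k, hk⟩ := hne
  have hin : ∀ l, ∀ v : L, (v : Plane) ∈ square (l - ρ) → translates K L v ⊆ square l := by
    rintro l v hv _ ⟨x, hx, rfl⟩
    have := square_add (mem_square_of_norm_le (hρ x hx)) hv
    simpa using this
  have hout : ∀ l, ∀ v : L, (translates K L v ∩ square l).Nonempty →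
      (v : Plane) ∈ square (l + ρ) := by
    rintro l v ⟨_, ⟨x, hx, rfl⟩, hxl⟩
    have := square_add hxl (square_neg (mem_square_of_norm_le (hρ x hx)))
    simpa using this
  have hmem : ∀ v : L, (translates K L v).Nonempty := fun v => ⟨_, k, hk, rfl⟩
  constructor
  · refine Tendsto.limsup_eq ((tendsto_encard_div L
      (V := fun l => {v | (translates K L v ∩ square l).Nonempty}) (ρ := ρ) hout
      (fun l v hv => ?_) hfin).congr fun l => ?_)
    · have := hin l v hv
      rw [Set.mem_ofPred_eq, Set.inter_eq_left.mpr this]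
      exact hmem v
    · rw [← tsum_volume_translates]
      rfl
  · refine Tendsto.liminf_eq ((tendsto_encard_div L
      (V := fun l => {v | translates K L v ⊆ square l}) (ρ := ρ)
      (fun l v hv => hout l v ?_) hin hfin).congr fun l => ?_)
    · rw [Set.inter_eq_left.mpr hv]
      exact hmem v
    · rw [← tsum_volume_translates]
      rfl

end

/-! ### Affine transfer to the standard triangle. -/

section Transfer

variable (φ : (ℝ × ℝ) ≃L[ℝ] Plane)

/-- The preimage of a planar lattice under a linear equivalence. -/
noncomputable def pullback (L : Submodule ℤ Plane) : Submodule ℤ (ℝ × ℝ) := ZLattice.comap ℝ L φ.toLinearMap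

/-- The image of a planar lattice under a linear equivalence. -/
noncomputable def pushforward (L : Submodule ℤ (ℝ × ℝ)) : Submodule ℤ Plane :=
  ZLattice.comap ℝ L φ.symm.toLinearMap

theorem mem_pullback {L : Submodule ℤ Plane} {v : ℝ × ℝ} : v ∈ pullback φ L ↔ φ v ∈ L := Iff.rfl

theorem mem_pushforward {L : Submodule ℤ (ℝ × ℝ)} {v : Plane} :
    v ∈ pushforward φ L ↔ φ.symm v ∈ L := Iff.rfl

theorem pullback_pushforward (L : Submodule ℤ (ℝ × ℝ)) : pullback φ (pushforward φ L) = L := by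
  ext v; simp [mem_pullback, mem_pushforward]

theorem pushforward_pullback (L : Submodule ℤ Plane) : pushforward φ (pullback φ L) = L := by
  ext v; simp [mem_pullback, mem_pushforward]

theorem pushforward_injective : Function.Injective (pushforward φ) := fun L L' h => by
  rw [← pullback_pushforward φ L, h, pullback_pushforward]

theorem isLattice_pushforward (L : Submodule ℤ (ℝ × ℝ)) [DiscreteTopology L] [IsZLattice ℝ L] :
    IsLattice (pushforward φ L) :=
  ⟨inferInstanceAs (DiscreteTopology (ZLattice.comap ℝ L φ.symm.toLinearMap)),
    inferInstanceAs (IsZLattice ℝ (ZLattice.comap ℝ L φ.symm.toLinearMap))⟩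

instance pullback_discreteTopology (L : Submodule ℤ Plane) [DiscreteTopology L] :
    DiscreteTopology (pullback φ L) :=
  inferInstanceAs (DiscreteTopology (ZLattice.comap ℝ L φ.toLinearMap))

instance pullback_isZLattice (L : Submodule ℤ Plane) [DiscreteTopology L] [IsZLattice ℝ L] :
    IsZLattice ℝ (pullback φ L) :=
  inferInstanceAs (IsZLattice ℝ (ZLattice.comap ℝ L φ.toLinearMap))

/-- A linear equivalence multiplies all covolumes by the same factor. -/
theorem exists_covolume_factor : ∃ κ : ℝ, 0 < κ ∧ ∀ L : Submodule ℤ Plane, IsLattice L →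
    ZLattice.covolume L = κ * ZLattice.covolume (pullback φ L) := by
  -- The transported area is a Haar measure on `ℝ × ℝ`; `κ` is its ratio to `volume`.
  set ν : Measure (ℝ × ℝ) := (volume : Measure Plane).map φ.symm with hν
  have hmp : MeasurePreserving φ ν volume := by
    refine ⟨φ.continuous.measurable, ?_⟩
    rw [hν, Measure.map_map φ.continuous.measurable φ.symm.continuous.measurable]
    simp
  refine ⟨(Measure.addHaarScalarFactor ν volume : ℝ), ?_, fun L hL => ?_⟩
  · exact_mod_cast Measure.addHaarScalarFactor_pos_of_isAddHaarMeasure ν volume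
  obtain ⟨hd, hz⟩ := hL
  rw [← ZLattice.covolume_comap L volume ν hmp]
  change ZLattice.covolume (pullback φ L) ν = _
  have hF := ZLattice.isAddFundamentalDomain (Module.Free.chooseBasis ℤ (pullback φ L))
  rw [ZLattice.covolume_eq_measure_fundamentalDomain _ ν (hF ν),
    ZLattice.covolume_eq_measure_fundamentalDomain _ volume (hF volume)]
  conv_lhs => rw [Measure.isAddLeftInvariant_eq_smul ν volume]
  simp [Measure.real]

theorem encard_translates (a : Plane) (L : Submodule ℤ Plane) (D : Set (ℝ × ℝ)) (x : Plane) :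
    {i : L | x ∈ translates ((fun p => φ p + a) '' D) L i}.encard =
      {v | v ∈ pullback φ L ∧ φ.symm (x - a) - v ∈ D}.encard := by
  have hinj : Function.Injective (fun i : L => φ.symm (i : Plane)) :=
    φ.symm.injective.comp Subtype.val_injective
  rw [← hinj.encard_image]
  congr 1
  ext v
  constructor
  · rintro ⟨i, ⟨_, ⟨p, hp, rfl⟩, hx⟩, rfl⟩
    refine ⟨by simp [mem_pullback], ?_⟩
    have : φ.symm (x - a) - φ.symm (i : Plane) = p := by
      rw [← map_sub, ← hx]; simp; abel
    rwa [this]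
  · rintro ⟨hv, hD⟩
    refine ⟨⟨φ v, hv⟩, ⟨_, ⟨_, hD, rfl⟩, ?_⟩, by simp⟩
    simp; abel

theorem encard_translates_forall (a : Plane) (L : Submodule ℤ Plane) (D : Set (ℝ × ℝ))
    (P : ℕ∞ → Prop) :
    (∀ x ∈ Set.univ, P {i : L | x ∈ translates ((fun p => φ p + a) '' D) L i}.encard) ↔
      ∀ z, P {v | v ∈ pullback φ L ∧ z - v ∈ D}.encard := by
  simp_rw [encard_translates]
  constructor
  · intro h z
    simpa using h (φ z + a) (Set.mem_univ _)
  · exact fun h x _ => h _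

theorem interior_closedTriangle (s : ℝ) : interior (closedTriangle s) = openTriangle s := by
  apply Set.Subset.antisymm
  · intro p hp
    -- An interior point can move a little in any direction; moving towards each side makes its
    -- inequality strict.
    have key : ∀ d : ℝ × ℝ, ∃ t : ℝ, 0 < t ∧ p + t • d ∈ closedTriangle s := by
      intro d
      have hc : Filter.Tendsto (fun t : ℝ => p + t • d) (nhdsWithin 0 (Set.Ioi 0)) (nhds p) := by
        have : Continuous fun t : ℝ => p + t • d := by fun_prop
        have h := this.tendsto 0
        simp only [zero_smul, add_zero] at h
        exact h.mono_left nhdsWithin_le_nhds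
      obtain ⟨t, ht, ht0⟩ := ((hc.eventually (mem_interior_iff_mem_nhds.mp hp)).and
        self_mem_nhdsWithin).exists
      exact ⟨t, ht0, ht⟩
    obtain ⟨h1, h2, h3⟩ := interior_subset hp
    refine ⟨?_, ?_, ?_⟩
    · obtain ⟨t, ht, h, -⟩ := key (-1, 0)
      simp at h; linarith
    · obtain ⟨t, ht, -, h, -⟩ := key (0, -1)
      simp at h; linarith
    · obtain ⟨t, ht, -, -, h⟩ := key (1, 0)
      simp at h; linarith
  · refine interior_maximal (fun p hp => ⟨hp.1.le, hp.2.1.le, hp.2.2.le⟩) ?_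
    exact (isOpen_lt continuous_const continuous_fst).inter
      ((isOpen_lt continuous_const continuous_snd).inter
        (isOpen_lt (continuous_fst.add continuous_snd) continuous_const))

theorem interior_affine_image (a : Plane) (D : Set (ℝ × ℝ)) :
    interior ((fun p => φ p + a) '' D) = (fun p => φ p + a) '' interior D :=
  ((φ.toHomeomorph.trans (Homeomorph.addRight a)).image_interior D).symm

theorem mem_packingLattices_iff (j : ℕ) (a : Plane) (s : ℝ) (L : Submodule ℤ Plane) :
    L ∈ packingLattices j ((fun p => φ p + a) '' closedTriangle s) ↔
      IsLattice L ∧ ∀ z, {v | v ∈ pullback φ L ∧ z - v ∈ openTriangle s}.encard ≤ j := by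
  refine and_congr_right fun _ => ?_
  rw [← encard_translates_forall φ a L (openTriangle s) (· ≤ (j : ℕ∞))]
  have hint : ∀ i : L, interior (translates ((fun p => φ p + a) '' closedTriangle s) L i) =
      translates ((fun p => φ p + a) '' openTriangle s) L i := by
    intro i
    rw [← interior_closedTriangle, ← interior_affine_image]
    exact ((Homeomorph.addRight (i : Plane)).image_interior _).symm
  simp only [IsFoldPacking, Set.subset_univ, true_and, hint]

theorem mem_coveringLattices_iff (j : ℕ) (a : Plane) (s : ℝ) (L : Submodule ℤ Plane) :
    L ∈ coveringLattices j ((fun p => φ p + a) '' closedTriangle s) ↔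
      IsLattice L ∧ ∀ z, (j : ℕ∞) ≤ {v | v ∈ pullback φ L ∧ z - v ∈ closedTriangle s}.encard :=
  and_congr_right fun _ => encard_translates_forall φ a L (closedTriangle s) ((j : ℕ∞) ≤ ·)

end Transfer

/-- Every triangle is an affine image of a standard right triangle. -/
theorem exists_affine_image {A : Fin 3 → Plane} (hA : AffineIndependent ℝ A) {s : ℝ} (hs : 0 < s) :
    ∃ φ : (ℝ × ℝ) ≃L[ℝ] Plane,
      convexHull ℝ (Set.range A) = (fun p => φ p + A 0) '' closedTriangle s := by
  let ψ : (ℝ × ℝ) →ₗ[ℝ] Plane :=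
    (LinearMap.fst ℝ ℝ ℝ).smulRight (s⁻¹ • (A 1 - A 0)) +
      (LinearMap.snd ℝ ℝ ℝ).smulRight (s⁻¹ • (A 2 - A 0))
  have hψ : ∀ p, ψ p = (p.1 / s) • (A 1 - A 0) + (p.2 / s) • (A 2 - A 0) := by
    intro p
    simp [ψ, smul_smul, div_eq_mul_inv]
  have hli : LinearIndependent ℝ ![A 1 - A 0, A 2 - A 0] := by
    rw [affineIndependent_iff_linearIndependent_vsub ℝ A 0] at hA
    let f : Fin 2 → {x : Fin 3 // x ≠ 0} := ![⟨1, by decide⟩, ⟨2, by decide⟩]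
    have hf : Function.Injective f := by
      intro a b h
      fin_cases a <;> fin_cases b <;> simp_all [f]
    have := hA.comp f hf
    have he : ![A 1 - A 0, A 2 - A 0] =
        (fun i : {x : Fin 3 // x ≠ 0} => A i -ᵥ A 0) ∘ f := by
      ext i
      fin_cases i <;> rfl
    rw [he]
    exact this
  have hinj : Function.Injective ψ := by
    rw [← LinearMap.ker_eq_bot, LinearMap.ker_eq_bot']
    intro p hp
    rw [hψ] at hp
    obtain ⟨h1, h2⟩ := LinearIndependent.pair_iff.mp hli _ _ hp
    have h1 : p.1 = 0 := by simpa [hs.ne'] using h1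
    have h2 : p.2 = 0 := by simpa [hs.ne'] using h2
    exact Prod.ext h1 h2
  let φ := (LinearEquiv.ofInjectiveOfFinrankEq ψ hinj (by simp)).toContinuousLinearEquiv
  have hφ : ∀ p, φ p = (p.1 / s) • (A 1 - A 0) + (p.2 / s) • (A 2 - A 0) := hψ
  refine ⟨φ, Set.Subset.antisymm (convexHull_min ?_ ?_) ?_⟩
  · rintro _ ⟨i, rfl⟩
    fin_cases i
    · exact ⟨0, ⟨le_rfl, le_rfl, by simpa using hs.le⟩, by simp⟩
    · exact ⟨(s, 0), ⟨hs.le, le_rfl, by simp⟩, by simp [hφ, hs.ne']⟩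
    · exact ⟨(0, s), ⟨le_rfl, hs.le, by simp⟩, by simp [hφ, hs.ne']⟩
  · have hconv : Convex ℝ (closedTriangle s) := by
      rintro p ⟨h1, h2, h3⟩ q ⟨h4, h5, h6⟩ a b ha hb hab
      refine ⟨?_, ?_, ?_⟩
      · simp only [Prod.fst_add, Prod.smul_fst, smul_eq_mul]; positivity
      · simp only [Prod.snd_add, Prod.smul_snd, smul_eq_mul]; positivity
      · simp only [Prod.fst_add, Prod.smul_fst, Prod.snd_add, Prod.smul_snd, smul_eq_mul]
        have : b = 1 - a := by linarith
        nlinarith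
    have := (hconv.is_linear_image (f := φ) φ.toLinearMap.isLinear).translate (A 0)
    rw [Set.image_image] at this
    simpa only [add_comm] using this
  · rintro _ ⟨p, ⟨h1, h2, h3⟩, rfl⟩
    have hmem : ∀ i, A i ∈ convexHull ℝ (Set.range A) := fun i =>
      subset_convexHull ℝ _ ⟨i, rfl⟩
    have h4 : p.1 / s + p.2 / s ≤ 1 := by rw [← add_div]; exact (div_le_one hs).mpr h3
    have := (convex_convexHull ℝ (Set.range A)).sum_mem (t := Finset.univ)
      (w := ![1 - p.1 / s - p.2 / s, p.1 / s, p.2 / s]) (z := A) ?_ ?_ fun i _ => hmem i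
    · convert this using 1
      simp only [hφ, Fin.sum_univ_three]
      simp
      module
    · intro i _
      fin_cases i
      · simp; linarith
      · exact div_nonneg h1 hs.le
      · exact div_nonneg h2 hs.le
    · simp [Fin.sum_univ_three]; ring

/-! ### Optimal lattices and their number. -/

/-- The residues that define the optimal lattices. -/
def unitPairs (n : ℕ) : Set (ZMod n) := {c | IsUnit c ∧ IsUnit (c + 1)}

/-- `-j` inverts `2`. This provides a lattice at which the extremal density is attained. -/
theorem one_mem_unitPairs (j : ℕ) : (1 : ZMod (2 * j + 1)) ∈ unitPairs (2 * j + 1) := by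
  refine ⟨isUnit_one, ?_⟩
  have h := two_mul_natCast_zmod j
  refine IsUnit.of_mul_eq_one (-(j : ZMod (2 * j + 1))) ?_
  linear_combination -h

theorem ncard_image_unitPairs {n : ℕ} {α : Type*} {f : ZMod n → α} (hf : Function.Injective f) [NeZero n] :
    (f '' unitPairs n).Finite ∧ (f '' unitPairs n).ncard = unitPairCount n := by
  refine ⟨(Set.toFinite _).image f, ?_⟩
  rw [Set.ncard_image_of_injective _ hf]
  exact (Nat.card_coe_set_eq _).symm

theorem div_ofReal_mul_inj {V : ℝ≥0∞} (h0 : V ≠ 0) (ht : V ≠ ⊤) {κ a b : ℝ} (hκ : 0 < κ)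
    (ha : 0 < a) (hb : 0 < b) (h : V / ENNReal.ofReal (κ * a) = V / ENNReal.ofReal (κ * b)) :
    a = b := by
  rw [ENNReal.div_eq_inv_mul, ENNReal.div_eq_inv_mul, ENNReal.mul_left_inj h0 ht, inv_inj,
    ENNReal.ofReal_eq_ofReal_iff (by positivity) (by positivity)] at h
  exact mul_left_cancel₀ hκ.ne' h

section

variable {j : ℕ} (φ : (ℝ × ℝ) ≃L[ℝ] Plane)

/-- The lattices of the optimal packings and coverings with an affine image of the standard
triangle. -/
noncomputable def optimalLattice (j : ℕ) (c : ZMod (2 * j + 1)) : Submodule ℤ Plane :=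
  pushforward φ (congruenceLattice (2 * j + 1) c)

theorem optimalLattice_injective (j : ℕ) : Function.Injective (optimalLattice φ j) :=
  (pushforward_injective φ).comp (congruenceLattice_injective _)

theorem isLattice_optimalLattice (c : ZMod (2 * j + 1)) : IsLattice (optimalLattice φ j c) :=
  isLattice_pushforward φ _

theorem covolume_pullback_pos {L : Submodule ℤ Plane} (hL : IsLattice L) :
    0 < ZLattice.covolume (pullback φ L) := by
  obtain ⟨hd, hz⟩ := hL
  exact ZLattice.covolume_pos _ _

theorem density_eq {K : Set Plane} (hK : Bornology.IsBounded K) (hne : K.Nonempty)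
    {κ : ℝ} (hκ : ∀ L : Submodule ℤ Plane, IsLattice L →
      ZLattice.covolume L = κ * ZLattice.covolume (pullback φ L))
    {L : Submodule ℤ Plane} (hL : IsLattice L) :
    upperDensity (translates K L) =
      volume K / ENNReal.ofReal (κ * ZLattice.covolume (pullback φ L)) ∧
    lowerDensity (translates K L) =
      volume K / ENNReal.ofReal (κ * ZLattice.covolume (pullback φ L)) := by
  rw [← hκ L hL]
  obtain ⟨hd, hz⟩ := hL
  exact density_translates L hK hne

theorem mem_image_optimalLattice (hj : 1 ≤ j) {L : Submodule ℤ Plane} (hL : IsLattice L)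
    (hcov : ZLattice.covolume (pullback φ L) = 2 * j + 1)
    (hst : stair (pullback φ L) j = unitStair j) :
    L ∈ optimalLattice φ j '' unitPairs (2 * j + 1) := by
  obtain ⟨hd, hz⟩ := hL
  obtain ⟨c, hc, hcL⟩ := exists_congruenceLattice hj hst hcov
  exact ⟨c, hc, by rw [optimalLattice, hcL, pushforward_pullback]⟩

theorem covolume_pullback_optimalLattice (hj : 1 ≤ j) {c : ZMod (2 * j + 1)}
    (hc : c ∈ unitPairs (2 * j + 1)) :
    ZLattice.covolume (pullback φ (optimalLattice φ j c)) = 2 * j + 1 := by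
  rw [optimalLattice, pullback_pushforward]
  exact covolume_congruenceLattice hj hc.1 hc.2

theorem affine_image_closedTriangle_facts (a : Plane) {s : ℝ} (hs : 0 < s) {K : Set Plane}
    (hK : K = (fun p => φ p + a) '' closedTriangle s) (hb : Bornology.IsBounded K) :
    K.Nonempty ∧ volume K ≠ 0 ∧ volume K ≠ ⊤ := by
  have hopen : (interior K).Nonempty := by
    rw [hK, interior_affine_image, interior_closedTriangle]
    refine Set.Nonempty.image _ ⟨(s / 3, s / 3), ?_, ?_, ?_⟩ <;> simp only <;> linarith
  exact ⟨hopen.mono interior_subset, (MeasureTheory.Measure.measure_pos_of_nonempty_interior _ hopen).ne',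
    hb.measure_lt_top.ne⟩

/-- The optimal packing lattices of an affine image of the standard triangle. -/
theorem optimalPackingLattices_eq (hj : 1 ≤ j) (a : Plane) {K : Set Plane}
    (hb : Bornology.IsBounded K) (hK : K = (fun p => φ p + a) '' closedTriangle (2 * j)) :
    optimalPackingLattices j K = optimalLattice φ j '' unitPairs (2 * j + 1) := by
  have hj0 : (0 : ℝ) < j := by exact_mod_cast hj
  obtain ⟨hne, hV0, hVt⟩ := affine_image_closedTriangle_facts φ a (by positivity) hK hb
  obtain ⟨κ, hκ0, hκ⟩ := exists_covolume_factor φ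
  have hdens := fun {L} hL => (density_eq φ hb hne hκ (L := L) hL).1
  have hbound : ∀ L ∈ packingLattices j K, IsLattice L ∧
      2 * (j : ℝ) + 1 ≤ ZLattice.covolume (pullback φ L) ∧
      (ZLattice.covolume (pullback φ L) = 2 * (j : ℝ) + 1 →
        L ∈ optimalLattice φ j '' unitPairs (2 * j + 1)) := by
    intro L hL
    rw [hK, mem_packingLattices_iff] at hL
    obtain ⟨hlat, hpack⟩ := hL
    obtain ⟨hd, hz⟩ := hlat
    obtain ⟨h1, h2⟩ := packing_bound (pullback φ L) hj hpack
    exact ⟨⟨hd, hz⟩, h1, fun h => mem_image_optimalLattice φ hj ⟨hd, hz⟩ h (h2 h)⟩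
  have hmem : ∀ c ∈ unitPairs (2 * j + 1), optimalLattice φ j c ∈ packingLattices j K := by
    intro c hc
    rw [hK, mem_packingLattices_iff, optimalLattice, pullback_pushforward]
    exact ⟨isLattice_optimalLattice φ c, packing_congruenceLattice hc.1 hc.2⟩
  have hval : ∀ c ∈ unitPairs (2 * j + 1), upperDensity (translates K (optimalLattice φ j c)) =
      volume K / ENNReal.ofReal (κ * (2 * j + 1)) := fun c hc => by
    rw [hdens (isLattice_optimalLattice φ c), covolume_pullback_optimalLattice φ hj hc]
  have hsup : latticePackingDensity j K = volume K / ENNReal.ofReal (κ * (2 * j + 1)) := by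
    refine le_antisymm (iSup₂_le fun L hL => ?_) ?_
    · obtain ⟨hlat, h1, -⟩ := hbound L hL
      rw [hdens hlat]
      exact ENNReal.div_le_div_left
        (ENNReal.ofReal_le_ofReal (mul_le_mul_of_nonneg_left h1 hκ0.le)) _
    · rw [← hval 1 (one_mem_unitPairs j)]
      exact le_iSup₂ (f := fun L (_ : L ∈ packingLattices j K) => upperDensity (translates K L)) _
        (hmem 1 (one_mem_unitPairs j))
  ext L
  constructor
  · rintro ⟨hL, hopt⟩
    obtain ⟨hlat, -, h2⟩ := hbound L hL
    rw [hsup, hdens hlat] at hopt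
    exact h2 (div_ofReal_mul_inj hV0 hVt hκ0 (covolume_pullback_pos φ hlat) (by positivity) hopt)
  · rintro ⟨c, hc, rfl⟩
    exact ⟨hmem c hc, by rw [hsup, hval c hc]⟩

/-- The optimal covering lattices of an affine image of the standard triangle. -/
theorem optimalCoveringLattices_eq (hj : 1 ≤ j) (a : Plane) {K : Set Plane}
    (hb : Bornology.IsBounded K) (hK : K = (fun p => φ p + a) '' closedTriangle (2 * j + 1)) :
    optimalCoveringLattices j K = optimalLattice φ j '' unitPairs (2 * j + 1) := by
  obtain ⟨hne, hV0, hVt⟩ := affine_image_closedTriangle_facts φ a (by positivity) hK hb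
  obtain ⟨κ, hκ0, hκ⟩ := exists_covolume_factor φ
  have hdens := fun {L} hL => (density_eq φ hb hne hκ (L := L) hL).2
  have hbound : ∀ L ∈ coveringLattices j K, IsLattice L ∧
      ZLattice.covolume (pullback φ L) ≤ 2 * (j : ℝ) + 1 ∧
      (ZLattice.covolume (pullback φ L) = 2 * (j : ℝ) + 1 →
        L ∈ optimalLattice φ j '' unitPairs (2 * j + 1)) := by
    intro L hL
    rw [hK, mem_coveringLattices_iff] at hL
    obtain ⟨hlat, hcover⟩ := hL
    obtain ⟨hd, hz⟩ := hlat
    obtain ⟨h1, h2⟩ := covering_bound (pullback φ L) hj hcover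
    exact ⟨⟨hd, hz⟩, h1, fun h => mem_image_optimalLattice φ hj ⟨hd, hz⟩ h (h2 h)⟩
  have hmem : ∀ c ∈ unitPairs (2 * j + 1), optimalLattice φ j c ∈ coveringLattices j K := by
    intro c hc
    rw [hK, mem_coveringLattices_iff, optimalLattice, pullback_pushforward]
    exact ⟨isLattice_optimalLattice φ c, covering_congruenceLattice hc.1 hc.2⟩
  have hval : ∀ c ∈ unitPairs (2 * j + 1), lowerDensity (translates K (optimalLattice φ j c)) =
      volume K / ENNReal.ofReal (κ * (2 * j + 1)) := fun c hc => by
    rw [hdens (isLattice_optimalLattice φ c), covolume_pullback_optimalLattice φ hj hc]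
  have hinf : latticeCoveringDensity j K = volume K / ENNReal.ofReal (κ * (2 * j + 1)) := by
    refine le_antisymm ?_ (le_iInf₂ fun L hL => ?_)
    · rw [← hval 1 (one_mem_unitPairs j)]
      exact iInf₂_le (f := fun L (_ : L ∈ coveringLattices j K) => lowerDensity (translates K L)) _
        (hmem 1 (one_mem_unitPairs j))
    · obtain ⟨hlat, h1, -⟩ := hbound L hL
      rw [hdens hlat]
      exact ENNReal.div_le_div_left
        (ENNReal.ofReal_le_ofReal (mul_le_mul_of_nonneg_left h1 hκ0.le)) _
  ext L
  constructor
  · rintro ⟨hL, hopt⟩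
    obtain ⟨hlat, -, h2⟩ := hbound L hL
    rw [hinf, hdens hlat] at hopt
    exact h2 (div_ofReal_mul_inj hV0 hVt hκ0 (covolume_pullback_pos φ hlat) (by positivity) hopt)
  · rintro ⟨c, hc, rfl⟩
    exact ⟨hmem c hc, by rw [hinf, hval c hc]⟩

end

end MultipleLattice

theorem corollary1 (j : ℕ) (hj : 1 ≤ j) (A : Fin 3 → MultipleLattice.Plane)
    (hA : AffineIndependent ℝ A) (T : Set MultipleLattice.Plane)
    (hT : T = convexHull ℝ (Set.range A)) :
    (MultipleLattice.optimalPackingLattices j T).Finite ∧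
    (MultipleLattice.optimalCoveringLattices j T).Finite ∧
    (MultipleLattice.optimalPackingLattices j T).ncard =
      (MultipleLattice.optimalCoveringLattices j T).ncard ∧
    ((MultipleLattice.optimalPackingLattices j T).ncard : ℝ) =
      (2 * (j : ℝ) + 1) * ∏ p ∈ (2 * j + 1).primeFactors, (1 - 2 / (p : ℝ)) ∧
    ((MultipleLattice.optimalCoveringLattices j T).ncard : ℝ) =
      (2 * (j : ℝ) + 1) * ∏ p ∈ (2 * j + 1).primeFactors, (1 - 2 / (p : ℝ)) := by
  have hb : Bornology.IsBounded T := by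
    rw [hT]; exact ((Set.finite_range A).isCompact_convexHull ℝ).isBounded
  have hj0 : (0 : ℝ) < j := by exact_mod_cast hj
  -- The two scalings differ so that the same unit staircase contains the open triangle of the
  -- packing and lies in the closed triangle of the covering.
  obtain ⟨φ, hφ⟩ := MultipleLattice.exists_affine_image hA (s := 2 * j) (by positivity)
  obtain ⟨ψ, hψ⟩ := MultipleLattice.exists_affine_image hA (s := 2 * j + 1) (by positivity)
  rw [MultipleLattice.optimalPackingLattices_eq φ hj (A 0) hb (hT.trans hφ),
    MultipleLattice.optimalCoveringLattices_eq ψ hj (A 0) hb (hT.trans hψ)]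
  obtain ⟨h1, h2⟩ :=
    MultipleLattice.ncard_image_unitPairs (MultipleLattice.optimalLattice_injective φ j)
  obtain ⟨h3, h4⟩ :=
    MultipleLattice.ncard_image_unitPairs (MultipleLattice.optimalLattice_injective ψ j)
  have hcount := MultipleLattice.unitPairCount_eq (n := 2 * j + 1) (by omega)
  push_cast at hcount
  rw [h2, h4]
  exact ⟨h1, h3, rfl, hcount, hcount⟩
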